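/- Let $\Sigma$ be the Euclidean Schwarzschild quotient surface: $\Sigma=\mathbb{C}$ with global holomorphic coordinate $z$ and Riemannian metric $$g_\Sigma=\frac{2}{(1+\rho)^3e^{\rho}}\,|dz|^2,\qquad \rho\ge 0,\quad \rho e^{\rho}=|z|^2,$$ which in the polar coordinates given by $z=\sqrt{\rho}\,e^{\rho/2-it}$ reads $g_\Sigma=\frac{2\rho}{(\rho+1)^3}dt^2+\frac{1}{2\rho(\rho+1)}d\rho^2$. Let $\Lambda$ denote contraction of 2-forms with its volume form. Let $\mathcal{N}\to\Sigma$ be a holomorphic line bundle with a smooth Hermitian structure $H$, conjugate-linear in the first variable, and let $(\nabla,\Phi)$ be a 4-vortex on $\mathcal{N}$: $\nabla$ is an $H$-Hermitian connection whose $(0,1)$-part $\bar\partial_\nabla$ is the Dolbeault operator of $\mathcal{N}$, and $\Phi$ is a smooth section with $$\bar\partial_\nabla\Phi=0,\qquad 2i\Lambda F_\nabla=4-|\Phi|_H^2 .$$ Then there are a smooth function $\alpha:\mathbb{C}\to\mathbb{R}$ and an isomorphism of holomorphic Hermitian line bundles from $\mathcal{N}$ to the trivial holomorphic line bundle $\underline{\mathbb{C}}$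 with the Hermitian structure $(\phi,\psi)\mapsto\overline{\phi}\,\psi\,e^{-\alpha}$, such that $F_\nabla$ and $\partial\bar\partial\alpha$ are integrable over $\Sigma$, $$\deg(\nabla)=\frac{i}{2\pi}\int_\Sigma F_\nabla=\frac{i}{2\pi}\int_\Sigma\partial\bar\partial\alpha\in\mathbb{R},$$ this number is less than $2$ if $\Phi$ is not identically zero, and the isomorphism takes $\Phi$ to a polynomial in $z$ of degree at most $1$ (possibly the zero polynomial). -/

import Mathlib

open Bundle
open scoped ContDiff ComplexConjugate

/-! ### The quotient surface -/

/-- For every `r ≥ 0` there is a unique `ρ ≥ 0` with `ρ e^ρ = r`. -/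
theorem esRho_existsUnique (r : ℝ) (hr : 0 ≤ r) : ∃! ρ : ℝ, 0 ≤ ρ ∧ ρ * Real.exp ρ = r := by
  have hmono : ∀ a b : ℝ, 0 ≤ a → a < b → a * Real.exp a < b * Real.exp b := by
    intro a b ha hab
    have h1 : Real.exp a < Real.exp b := Real.exp_lt_exp.mpr hab
    have h2 := Real.exp_pos a
    nlinarith
  have hc : ContinuousOn (fun ρ : ℝ => ρ * Real.exp ρ) (Set.Icc 0 r) := by fun_prop
  have hmem : r ∈ Set.Icc ((0 : ℝ) * Real.exp 0) (r * Real.exp r) := by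
    have h1 : 1 ≤ Real.exp r := Real.one_le_exp hr
    constructor
    · simpa using hr
    · nlinarith
  obtain ⟨ρ, hρ, hρr⟩ := intermediate_value_Icc hr hc hmem
  refine ⟨ρ, ⟨hρ.1, hρr⟩, ?_⟩
  rintro σ ⟨hσ, hσr⟩
  have hρr' : ρ * Real.exp ρ = r := hρr
  rcases lt_trichotomy σ ρ with h | h | h
  · have := hmono σ ρ hσ h; linarith
  · exact h
  · have := hmono ρ σ hρ.1 h; linarith

/-- The radial coordinate `ρ ≥ 0` of the surface, as a function of the global holomorphic
coordinate `z`: the unique `ρ ≥ 0` with `ρ e^ρ = |z|²`. -/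
noncomputable def esRho (z : ℂ) : ℝ :=
  Classical.choose (esRho_existsUnique (‖z‖ ^ 2) (sq_nonneg _)).exists

theorem esRho_nonneg (z : ℂ) : 0 ≤ esRho z :=
  (Classical.choose_spec (esRho_existsUnique (‖z‖ ^ 2) (sq_nonneg _)).exists).1

theorem esRho_mul_exp (z : ℂ) : esRho z * Real.exp (esRho z) = ‖z‖ ^ 2 :=
  (Classical.choose_spec (esRho_existsUnique (‖z‖ ^ 2) (sq_nonneg _)).exists).2

/-- The Euclidean Schwarzschild quotient surface `Σ` is `ℂ`, with its standard complex structure and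
orientation, and with the Riemannian metric `g_Σ = esDensity z |dz|²`. Its volume form is
`esDensity z dx ∧ dy`. -/
noncomputable def esDensity (z : ℂ) : ℝ :=
  2 / ((1 + esRho z) ^ 3 * Real.exp (esRho z))

/-- The coordinate `z = √ρ exp(ρ/2 - i t)` in terms of the polar coordinates `(t, ρ)`. -/
noncomputable def esPolar (t ρ : ℝ) : ℂ :=
  (Real.sqrt ρ : ℂ) * Complex.exp ((ρ : ℂ) / 2 - Complex.I * t)

/-- In the polar coordinates the metric is
`2ρ/(ρ+1)³ dt² + 1/(2ρ(ρ+1)) dρ²`. -/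
theorem esMetric_polar (t ρ : ℝ) (hρ : 0 < ρ) : ∃ zt zρ : ℂ,
    HasDerivAt (fun t' => esPolar t' ρ) zt t ∧ HasDerivAt (fun ρ' => esPolar t ρ') zρ ρ ∧
    ∀ a b : ℝ, esDensity (esPolar t ρ) * ‖(a : ℂ) * zt + (b : ℂ) * zρ‖ ^ 2 =
      2 * ρ / (ρ + 1) ^ 3 * a ^ 2 + 1 / (2 * ρ * (ρ + 1)) * b ^ 2 := by
  have hs : 0 < Real.sqrt ρ := Real.sqrt_pos.mpr hρ
  have hss : Real.sqrt ρ * Real.sqrt ρ = ρ := Real.mul_self_sqrt hρ.le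
  have hnorm : ‖esPolar t ρ‖ ^ 2 = ρ * Real.exp ρ := by
    have h1 : ((ρ : ℂ) / 2 - Complex.I * t).re = ρ / 2 := by simp
    rw [esPolar, norm_mul, Complex.norm_exp, h1, Complex.norm_real, Real.norm_eq_abs,
      abs_of_pos hs, mul_pow, Real.sq_sqrt hρ.le, ← Real.exp_nat_mul]
    congr 2
    push_cast
    ring
  have hrho : esRho (esPolar t ρ) = ρ :=
    (esRho_existsUnique (‖esPolar t ρ‖ ^ 2) (sq_nonneg _)).unique
      ⟨esRho_nonneg _, esRho_mul_exp _⟩ ⟨hρ.le, hnorm.symm⟩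
  refine ⟨-Complex.I * esPolar t ρ, ((1 + ρ) / (2 * ρ) : ℝ) * esPolar t ρ, ?_, ?_, ?_⟩
  · have h : HasDerivAt (fun t' : ℝ => (ρ : ℂ) / 2 - Complex.I * t') (-(Complex.I * 1)) t :=
      ((Complex.ofRealCLM.hasDerivAt (x := t)).const_mul Complex.I).const_sub _
    refine (h.cexp.const_mul (Real.sqrt ρ : ℂ)).congr_deriv ?_
    rw [esPolar]
    ring
  · have h : HasDerivAt (fun ρ' : ℝ => (ρ' : ℂ) / 2 - Complex.I * t) (1 / 2) ρ :=
      ((Complex.ofRealCLM.hasDerivAt (x := ρ)).div_const 2).sub_const _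
    have h2 : HasDerivAt (fun ρ' : ℝ => (Real.sqrt ρ' : ℂ))
        ((1 / (2 * Real.sqrt ρ) : ℝ) : ℂ) ρ :=
      (Real.hasDerivAt_sqrt hρ.ne').ofReal_comp
    refine (h2.mul h.cexp).congr_deriv ?_
    have hsC : (Real.sqrt ρ : ℂ) ^ 2 = ρ := by
      rw [sq]
      exact_mod_cast hss
    have hs0 : (Real.sqrt ρ : ℂ) ≠ 0 := by exact_mod_cast hs.ne'
    rw [esPolar]
    push_cast
    rw [← hsC]
    field_simp
    try ring
  · intro a b
    have h1 : (a : ℂ) * (-Complex.I * esPolar t ρ) +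
        (b : ℂ) * (((1 + ρ) / (2 * ρ) : ℝ) * esPolar t ρ) =
        (((b * ((1 + ρ) / (2 * ρ)) : ℝ) : ℂ) + ((-a : ℝ) : ℂ) * Complex.I) * esPolar t ρ := by
      push_cast
      ring
    rw [h1, norm_mul, mul_pow, hnorm, ← Complex.normSq_eq_norm_sq, Complex.normSq_add_mul_I,
      esDensity, hrho]
    have := Real.exp_pos ρ
    field_simp
    ring

/-! ### Differential forms on the surface

Tangent spaces are identified with `ℂ` through the coordinate `z = x + i y`, so that `1` is `∂_x` and
`Complex.I` is `∂_y`. -/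

/-- The `(0,1)`-part `v ↦ (L v + i L(i v)) / 2` of a vector-valued covector `L`, as a conjugate-linear
map. -/
noncomputable def zeroOnePart {V : Type*} [AddCommGroup V] [Module ℂ V] (L : ℂ →ₗ[ℝ] V) :
    ℂ →ₗ⋆[ℂ] V where
  toFun v := (1 / 2 : ℂ) • (L v + Complex.I • L (Complex.I * v))
  map_add' v w := by
    rw [mul_add, map_add, map_add]
    module
  map_smul' c v := by
    have hL : ∀ w : ℂ, L w = (w.re : ℂ) • L 1 + (w.im : ℂ) • L Complex.I := by
      intro w
      have h : w = w.re • (1 : ℂ) + w.im • Complex.I := by simp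
      conv_lhs => rw [h]
      rw [map_add, map_smul, map_smul]
      simp only [Complex.coe_smul]
    rw [hL (c • v), hL (Complex.I * (c • v)), hL v, hL (Complex.I * v)]
    match_scalars <;> apply Complex.ext <;> simp <;> ring

/-- `∂̄ f` at `x`, as a conjugate-linear form on the tangent space. -/
noncomputable def dbarFun (f : ℂ → ℂ) (x : ℂ) : ℂ →ₗ⋆[ℂ] ℂ :=
  zeroOnePart (fderiv ℝ f x : ℂ →ₗ[ℝ] ℂ)

/-- The Wirtinger derivative `∂f/∂z`. -/
noncomputable def wirtingerZ (f : ℂ → ℂ) (x : ℂ) : ℂ :=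
  (1 / 2) * (fderiv ℝ f x 1 - Complex.I * fderiv ℝ f x Complex.I)

/-- The Wirtinger derivative `∂f/∂z̄`. -/
noncomputable def wirtingerZbar (f : ℂ → ℂ) (x : ℂ) : ℂ :=
  (1 / 2) * (fderiv ℝ f x 1 + Complex.I * fderiv ℝ f x Complex.I)

/-- The function `u` with `∂∂̄α = u dx ∧ dy`, that is, the value of the 2-form
`∂∂̄α = (∂²α/∂z∂z̄) dz ∧ dz̄` on `(∂_x, ∂_y)`; here `dz ∧ dz̄ = -2i dx ∧ dy`. -/
noncomputable def ddbar (α : ℂ → ℝ) (x : ℂ) : ℂ :=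
  -2 * Complex.I * wirtingerZ (wirtingerZbar fun y => (α y : ℂ)) x

/-! ### Smooth complex line bundles over the surface -/

section LineBundles

universe u v

/-- A complex line bundle over `ℂ = ℝ²` is smooth if the transition functions between the
trivializations of its atlas are `C^∞` in the real sense. -/
class IsSmoothLineBundle (E : ℂ → Type u) [TopologicalSpace (TotalSpace ℂ E)]
    [∀ x, AddCommGroup (E x)] [∀ x, Module ℂ (E x)] [∀ x, TopologicalSpace (E x)]
    [FiberBundle ℂ E] [VectorBundle ℂ ℂ E] : Prop where
  contDiffOn_coordChange : ∀ (e e' : Trivialization ℂ (π ℂ E))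
    [MemTrivializationAtlas e] [MemTrivializationAtlas e'],
    ContDiffOn ℝ ∞ (fun x : ℂ => (e.coordChangeL ℂ e' x : ℂ →L[ℂ] ℂ)) (e.baseSet ∩ e'.baseSet)

variable {E : ℂ → Type u} [TopologicalSpace (TotalSpace ℂ E)]
  [∀ x, AddCommGroup (E x)] [∀ x, Module ℂ (E x)] [∀ x, TopologicalSpace (E x)]
  [FiberBundle ℂ E]

/-- A section is smooth if it is `C^∞` (in the real sense) in every trivialization of the atlas. -/
def IsSmoothSection (s : ∀ x, E x) : Prop :=
  ∀ (e : Trivialization ℂ (π ℂ E)) [MemTrivializationAtlas e],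
    ContDiffOn ℝ ∞ (fun x => (e ⟨x, s x⟩).2) e.baseSet

theorem IsSmoothSection.smul [VectorBundle ℂ ℂ E] {s : ∀ x, E x} (hs : IsSmoothSection s)
    {f : ℂ → ℂ} (hf : ContDiff ℝ ∞ f) : IsSmoothSection fun x => f x • s x := by
  intro e he
  refine (hf.contDiffOn.mul (hs e)).congr fun x hx => ?_
  exact (e.linear ℂ hx).map_smul (f x) (s x)

/-- Every point has a smooth section `σ`, not vanishing there, of which every smooth section is a
multiple, after multiplication with a function that is `1` at the point. -/
theorem exists_frame [VectorBundle ℂ ℂ E] [IsSmoothLineBundle E] (x : ℂ) :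
    ∃ σ : ∀ y, E y, IsSmoothSection σ ∧ (∀ a : E x, ∃ c : ℂ, a = c • σ x) ∧
      ∀ s : ∀ y, E y, IsSmoothSection s → ∃ f g : ℂ → ℂ, ContDiff ℝ ∞ f ∧ ContDiff ℝ ∞ g ∧
        f x = 1 ∧ ∀ y, f y • s y = g y • σ y := by
  set e := trivializationAt ℂ E x with he
  have hx : x ∈ e.baseSet := mem_baseSet_trivializationAt ℂ E x
  obtain ⟨r, hr, hrs⟩ := Metric.isOpen_iff.mp e.open_baseSet x hx
  let b : ContDiffBump x := ⟨r / 4, r / 2, by positivity, by linarith⟩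
  have hsupp : tsupport b ⊆ e.baseSet := by
    rw [b.tsupport_eq]
    exact (Metric.closedBall_subset_ball (by change r / 2 < r; linarith)).trans hrs
  have hbC : ContDiff ℝ ∞ fun y => ((b y : ℝ) : ℂ) := Complex.ofRealCLM.contDiff.comp b.contDiff
  have hbx : b x = 1 := b.one_of_mem_closedBall (by simp [b.rIn_pos.le])
  have hext : ∀ (U : Set ℂ) (_ : IsOpen U) (h : ℂ → ℂ), ContDiffOn ℝ ∞ h (e.baseSet ∩ U) →
      ContDiffOn ℝ ∞ (fun y => ((b y : ℝ) : ℂ) * h y) U := by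
    intro U hU h hh y hy
    by_cases hye : y ∈ e.baseSet
    · exact (hbC.contDiffAt.mul (hh.contDiffAt
        ((e.open_baseSet.inter hU).mem_nhds ⟨hye, hy⟩))).contDiffWithinAt
    · have h0 : (fun z => ((b z : ℝ) : ℂ) * h z) =ᶠ[nhds y] fun _ => 0 := by
        have hb0 := notMem_tsupport_iff_eventuallyEq.mp fun hc => hye (hsupp hc)
        filter_upwards [hb0] with z hz
        simp [hz]
      exact (contDiffAt_const.congr_of_eventuallyEq h0).contDiffWithinAt
  have hsymm : ∀ y ∈ e.baseSet, ∀ a : E y, a = (e ⟨y, a⟩).2 • e.symm y 1 := by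
    intro y hy a
    have h1 := e.symm_apply_apply_mk hy a
    have h2 : e.symm y ((e ⟨y, a⟩).2 • (1 : ℂ)) = (e ⟨y, a⟩).2 • e.symm y 1 := by
      have := (e.symmₗ ℂ y).map_smul ((e ⟨y, a⟩).2) 1
      rwa [e.symmₗ_apply hy, e.symmₗ_apply hy] at this
    rw [← h2, smul_eq_mul, mul_one, h1]
  refine ⟨fun y => ((b y : ℝ) : ℂ) • e.symm y 1, ?_, ?_, ?_⟩
  · intro e' he'
    have hcc := IsSmoothLineBundle.contDiffOn_coordChange (E := E) e e'
    have hcc1 : ContDiffOn ℝ ∞ (fun y => (e.coordChangeL ℂ e' y : ℂ →L[ℂ] ℂ) 1)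
        (e.baseSet ∩ e'.baseSet) :=
      ((ContinuousLinearMap.apply ℂ ℂ (1 : ℂ)).restrictScalars ℝ).contDiff.comp_contDiffOn hcc
    refine (hext e'.baseSet e'.open_baseSet _ hcc1).congr fun y hy => ?_
    rw [(e'.linear ℂ hy).map_smul, smul_eq_mul]
    by_cases hye : y ∈ e.baseSet
    · congr 1
      exact (e.coordChangeL_apply (R := ℂ) e' ⟨hye, hy⟩ 1).symm
    · have : b y = 0 := image_eq_zero_of_notMem_tsupport fun hc => hye (hsupp hc)
      simp [this]
  · intro a
    refine ⟨(e ⟨x, a⟩).2, ?_⟩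
    simpa [hbx] using hsymm x hx a
  · intro s hs
    refine ⟨fun y => ((b y : ℝ) : ℂ) * ((b y : ℝ) : ℂ), fun y => ((b y : ℝ) : ℂ) * (e ⟨y, s y⟩).2,
      hbC.mul hbC, ?_, by simp [hbx], ?_⟩
    · exact contDiffOn_univ.mp (hext Set.univ isOpen_univ _ (by simpa using hs e))
    · intro y
      by_cases hye : y ∈ e.baseSet
      · conv_lhs => rw [hsymm y hye (s y)]
        module
      · have : b y = 0 := image_eq_zero_of_notMem_tsupport fun hc => hye (hsupp hc)
        simp [this]

variable (E)

/-- A holomorphic structure on a smooth complex line bundle: a Dolbeault operator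
`∂̄_E : Γ(E) → Γ(Λ^{0,1} ⊗ E)`. (There is no integrability condition over a surface. Values on
sections that are not smooth play no role.) -/
structure HolomorphicStructure where
  dbar : (∀ x, E x) → ∀ x, ℂ →ₗ⋆[ℂ] E x
  smooth : ∀ s, IsSmoothSection s → ∀ v : ℂ, IsSmoothSection fun x => dbar s x v
  add : ∀ s t, IsSmoothSection s → IsSmoothSection t → ∀ x,
    dbar (fun y => s y + t y) x = dbar s x + dbar t x
  leibniz : ∀ (f : ℂ → ℂ) (s : ∀ x, E x), ContDiff ℝ ∞ f → IsSmoothSection s → ∀ x v,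
    dbar (fun y => f y • s y) x v = dbarFun f x v • s x + f x • dbar s x v

/-- A smooth Hermitian structure, conjugate-linear in the first variable. -/
structure HermitianStructure where
  inner : ∀ x, E x →ₗ⋆[ℂ] E x →ₗ[ℂ] ℂ
  conj_symm : ∀ x (a b : E x), conj (inner x a b) = inner x b a
  pos : ∀ x (a : E x), a ≠ 0 → 0 < (inner x a a).re
  smooth : ∀ s t, IsSmoothSection s → IsSmoothSection t →
    ContDiff ℝ ∞ fun x => inner x (s x) (t x)

/-- A connection `∇ : Γ(E) → Γ(T^* ⊗ E)`; `toFun s x v` is `∇_v s` at `x`. (Values on sections that are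
not smooth play no role.) -/
structure LineConnection where
  toFun : (∀ x, E x) → ∀ x, ℂ →ₗ[ℝ] E x
  smooth : ∀ s, IsSmoothSection s → ∀ v : ℂ, IsSmoothSection fun x => toFun s x v
  add : ∀ s t, IsSmoothSection s → IsSmoothSection t → ∀ x,
    toFun (fun y => s y + t y) x = toFun s x + toFun t x
  leibniz : ∀ (f : ℂ → ℂ) (s : ∀ x, E x), ContDiff ℝ ∞ f → IsSmoothSection s → ∀ x v,
    toFun (fun y => f y • s y) x v = fderiv ℝ f x v • s x + f x • toFun s x v

variable {E}

namespace LineConnection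

/-- `∇` is compatible with the Hermitian structure. -/
def IsHermitian (nab : LineConnection E) (H : HermitianStructure E) : Prop :=
  ∀ s t, IsSmoothSection s → IsSmoothSection t → ∀ x v : ℂ,
    fderiv ℝ (fun y => H.inner y (s y) (t y)) x v =
      H.inner x (nab.toFun s x v) (t x) + H.inner x (s x) (nab.toFun t x v)

/-- `∂̄_∇ s`, the `(0,1)`-part of `∇ s`. -/
noncomputable def dbar (nab : LineConnection E) (s : ∀ x, E x) (x : ℂ) : ℂ →ₗ⋆[ℂ] E x :=
  zeroOnePart (nab.toFun s x)

/-- `F_∇(∂_x, ∂_y) s = ∇_{∂_x} ∇_{∂_y} s - ∇_{∂_y} ∇_{∂_x} s` (the coordinate fields commute). -/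
noncomputable def curvatureOp (nab : LineConnection E) (s : ∀ x, E x) (x : ℂ) : E x :=
  nab.toFun (fun y => nab.toFun s y Complex.I) x 1 -
    nab.toFun (fun y => nab.toFun s y 1) x Complex.I

/-- The curvature, an endomorphism-valued (that is, scalar-valued) 2-form, as the function
`F_∇(∂_x, ∂_y)`, so that `F_∇ = curvature dx ∧ dy`: the scalar by which `F_∇(∂_x, ∂_y)` acts on the
fibre at `x`. -/
noncomputable def curvature (nab : LineConnection E) (x : ℂ) : ℂ :=
  Classical.epsilon fun c : ℂ => ∀ s, IsSmoothSection s → nab.curvatureOp s x = c • s x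

theorem curvatureOp_smul [VectorBundle ℂ ℂ E] (nab : LineConnection E) {f : ℂ → ℂ}
    (hf : ContDiff ℝ ∞ f) {s : ∀ x, E x} (hs : IsSmoothSection s) (x : ℂ) :
    nab.curvatureOp (fun y => f y • s y) x = f x • nab.curvatureOp s x := by
  have hd : ∀ w : ℂ, ContDiff ℝ ∞ fun y => fderiv ℝ f y w := fun w =>
    (hf.fderiv_right (m := ∞) (by simp)).clm_apply contDiff_const
  have hdd : ∀ v w : ℂ, fderiv ℝ (fun y => fderiv ℝ f y w) x v = fderiv ℝ (fderiv ℝ f) x v w := by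
    intro v w
    have h1 : DifferentiableAt ℝ (fderiv ℝ f) x :=
      (hf.fderiv_right (m := ∞) (by simp)).differentiable (by simp) x
    rw [fderiv_clm_apply h1 (differentiableAt_const w)]
    simp
  have hsym : fderiv ℝ (fderiv ℝ f) x 1 Complex.I = fderiv ℝ (fderiv ℝ f) x Complex.I 1 :=
    (hf.contDiffAt.isSymmSndFDerivAt (by
      rw [minSmoothness_of_isRCLikeNormedField]
      exact WithTop.coe_le_coe.mpr le_top)) 1 Complex.I
  have key : ∀ v w : ℂ, nab.toFun (fun y => nab.toFun (fun z => f z • s z) y w) x v =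
      fderiv ℝ (fderiv ℝ f) x v w • s x + fderiv ℝ f x w • nab.toFun s x v +
        (fderiv ℝ f x v • nab.toFun s x w + f x • nab.toFun (fun y => nab.toFun s y w) x v) := by
    intro v w
    have h1 : (fun y => nab.toFun (fun z => f z • s z) y w) =
        fun y => fderiv ℝ f y w • s y + f y • nab.toFun s y w := by
      funext y
      exact nab.leibniz f s hf hs y w
    rw [h1, nab.add _ _ (hs.smul (hd w)) ((nab.smooth s hs w).smul hf) x, LinearMap.add_apply,
      nab.leibniz _ _ (hd w) hs, nab.leibniz _ _ hf (nab.smooth s hs w), hdd]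
  rw [curvatureOp, curvatureOp, key, key, hsym]
  module

/-- The scalar in the definition of `curvature` exists. -/
theorem curvature_spec [VectorBundle ℂ ℂ E] [IsSmoothLineBundle E] (nab : LineConnection E) (x : ℂ)
    (s : ∀ y, E y) (hs : IsSmoothSection s) : nab.curvatureOp s x = nab.curvature x • s x := by
  have hex : ∃ c : ℂ, ∀ s, IsSmoothSection s → nab.curvatureOp s x = c • s x := by
    obtain ⟨σ, hσ, hbasis, hall⟩ := exists_frame (E := E) x
    obtain ⟨c, hc⟩ := hbasis (nab.curvatureOp σ x)
    refine ⟨c, fun s hs => ?_⟩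
    obtain ⟨f, g, hf, hg, hfx, hfg⟩ := hall s hs
    have h1 := nab.curvatureOp_smul hf hs x
    have h2 := nab.curvatureOp_smul hg hσ x
    have h3 := hfg x
    rw [hfx, one_smul] at h1 h3
    rw [← h1, funext hfg, h2, hc, h3]
    module
  exact Classical.epsilon_spec hex s hs

/-- `Λ F_∇`, the contraction of the curvature with the volume form `esDensity dx ∧ dy`. -/
noncomputable def lambdaCurvature (nab : LineConnection E) (x : ℂ) : ℂ :=
  nab.curvature x / (esDensity x : ℂ)

/-- The degree `(i / 2π) ∫_Σ F_∇`. -/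
noncomputable def degree (nab : LineConnection E) : ℂ :=
  Complex.I / (2 * Real.pi) * ∫ x : ℂ, nab.curvature x

end LineConnection

/-- `(∇, Φ)` is a `τ`-vortex on the holomorphic Hermitian line bundle `(E, D, H)` over `Σ`:
`∇` is a Hermitian connection inducing the holomorphic structure `D`, and `Φ` is a smooth section with
`∂̄_∇ Φ = 0` and `2 i Λ F_∇ = τ - |Φ|²`. -/
structure IsVortex (τ : ℝ) (D : HolomorphicStructure E) (H : HermitianStructure E)
    (nab : LineConnection E) (Φ : ∀ x, E x) : Prop where
  hermitian : nab.IsHermitian H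
  compatible : ∀ s, IsSmoothSection s → ∀ x, nab.dbar s x = D.dbar s x
  smooth : IsSmoothSection Φ
  holomorphic : ∀ x, nab.dbar Φ x = 0
  curvature_eq : ∀ x, 2 * Complex.I * nab.lambdaCurvature x = (τ : ℂ) - H.inner x (Φ x) (Φ x)

/-- An isomorphism of holomorphic Hermitian line bundles: a fibrewise linear isomorphism, smooth in
both directions, that intertwines the Dolbeault operators and is isometric. -/
structure HolomorphicHermitianIso {E' : ℂ → Type v} [TopologicalSpace (TotalSpace ℂ E')]
    [∀ x, AddCommGroup (E' x)] [∀ x, Module ℂ (E' x)] [∀ x, TopologicalSpace (E' x)]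
    [FiberBundle ℂ E'] (D : HolomorphicStructure E) (H : HermitianStructure E)
    (D' : HolomorphicStructure E') (H' : HermitianStructure E') where
  toEquiv : ∀ x, E x ≃ₗ[ℂ] E' x
  smooth_iff : ∀ s : ∀ x, E x, IsSmoothSection s ↔ IsSmoothSection fun x => toEquiv x (s x)
  dbar_comm : ∀ s, IsSmoothSection s → ∀ x v,
    D'.dbar (fun y => toEquiv y (s y)) x v = toEquiv x (D.dbar s x v)
  isometry : ∀ x (a b : E x), H'.inner x (toEquiv x a) (toEquiv x b) = H.inner x a b

end LineBundles

/-! ### The trivial holomorphic line bundle -/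

theorem isSmoothSection_trivial_iff (s : ∀ x, Bundle.Trivial ℂ ℂ x) :
    IsSmoothSection s ↔ ContDiff ℝ ∞ (fun x => (s x : ℂ)) := by
  constructor
  · intro h
    have := h (trivializationAt ℂ (Bundle.Trivial ℂ ℂ) 0)
    exact contDiffOn_univ.mp this
  · intro h e he
    obtain rfl := Bundle.Trivial.eq_trivialization ℂ ℂ e
    exact h.contDiffOn

/-- The trivial holomorphic line bundle `ℂ → Σ`, with the operator `∂̄` on functions. -/
noncomputable def trivialHolomorphic : HolomorphicStructure (Bundle.Trivial ℂ ℂ) where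
  dbar s x := dbarFun (fun y => (s y : ℂ)) x
  smooth s hs v := by
    rw [isSmoothSection_trivial_iff] at hs ⊢
    have h : ∀ w : ℂ, ContDiff ℝ ∞ fun x => fderiv ℝ (fun y => (s y : ℂ)) x w := fun w =>
      (hs.fderiv_right (m := ∞) (by simp)).clm_apply contDiff_const
    exact contDiff_const.mul ((h v).add (contDiff_const.mul (h (Complex.I * v))))
  add s t hs ht x := by
    rw [isSmoothSection_trivial_iff] at hs ht
    have h : fderiv ℝ (fun y => (s y : ℂ) + (t y : ℂ)) x =
        fderiv ℝ (fun y => (s y : ℂ)) x + fderiv ℝ (fun y => (t y : ℂ)) x :=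
      fderiv_fun_add (hs.differentiable (by simp) x) (ht.differentiable (by simp) x)
    refine LinearMap.ext fun v => ?_
    change (1 / 2 : ℂ) * (fderiv ℝ (fun y => (s y : ℂ) + (t y : ℂ)) x v +
      Complex.I * fderiv ℝ (fun y => (s y : ℂ) + (t y : ℂ)) x (Complex.I * v)) =
      (1 / 2 : ℂ) * (fderiv ℝ (fun y => (s y : ℂ)) x v +
        Complex.I * fderiv ℝ (fun y => (s y : ℂ)) x (Complex.I * v)) +
      (1 / 2 : ℂ) * (fderiv ℝ (fun y => (t y : ℂ)) x v +
        Complex.I * fderiv ℝ (fun y => (t y : ℂ)) x (Complex.I * v))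
    rw [h, add_apply, add_apply]
    ring
  leibniz f s hf hs x v := by
    rw [isSmoothSection_trivial_iff] at hs
    have h : fderiv ℝ (fun y => f y * (s y : ℂ)) x =
        f x • fderiv ℝ (fun y => (s y : ℂ)) x + (s x : ℂ) • fderiv ℝ f x :=
      fderiv_fun_mul (hf.differentiable (by simp) x) (hs.differentiable (by simp) x)
    change (1 / 2 : ℂ) * (fderiv ℝ (fun y => f y * (s y : ℂ)) x v +
      Complex.I * fderiv ℝ (fun y => f y * (s y : ℂ)) x (Complex.I * v)) =
      (1 / 2 : ℂ) * (fderiv ℝ f x v + Complex.I * fderiv ℝ f x (Complex.I * v)) * (s x : ℂ) +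
      f x * ((1 / 2 : ℂ) * (fderiv ℝ (fun y => (s y : ℂ)) x v +
        Complex.I * fderiv ℝ (fun y => (s y : ℂ)) x (Complex.I * v)))
    rw [h]
    simp only [add_apply, smul_apply, smul_eq_mul]
    ring

/-- The Hermitian structure `H(Φ, Ψ) = conj Φ Ψ e^{-α}` on the trivial line bundle. -/
noncomputable def trivialHermitian (α : ℂ → ℝ) (hα : ContDiff ℝ ∞ α) :
    HermitianStructure (Bundle.Trivial ℂ ℂ) where
  inner x := LinearMap.mk₂'ₛₗ (starRingEnd ℂ) (RingHom.id ℂ)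
    (fun a b : ℂ => conj a * b * (Real.exp (-α x) : ℂ))
    (by intro a b c; simp only [map_add]; ring)
    (by intro c a b; simp only [smul_eq_mul, map_mul]; ring)
    (by intro a b c; ring)
    (by intro c a b; simp only [smul_eq_mul, RingHom.id_apply]; ring)
  conj_symm x a b := by
    change conj (conj (a : ℂ) * (b : ℂ) * (Real.exp (-α x) : ℂ)) =
      conj (b : ℂ) * (a : ℂ) * (Real.exp (-α x) : ℂ)
    rw [map_mul, map_mul, Complex.conj_conj, Complex.conj_ofReal]
    ring
  pos x a ha := by
    change 0 < (conj (a : ℂ) * (a : ℂ) * (Real.exp (-α x) : ℂ)).re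
    rw [← Complex.normSq_eq_conj_mul_self, ← Complex.ofReal_mul, Complex.ofReal_re]
    exact mul_pos (Complex.normSq_pos.mpr ha) (Real.exp_pos _)
  smooth s t hs ht := by
    rw [isSmoothSection_trivial_iff] at hs ht
    change ContDiff ℝ ∞ fun x => conj (s x : ℂ) * (t x : ℂ) * (Real.exp (-α x) : ℂ)
    have h1 : ContDiff ℝ ∞ fun x => conj (s x : ℂ) := Complex.conjCLE.contDiff.comp hs
    have h2 : ContDiff ℝ ∞ fun x => (Real.exp (-α x) : ℂ) :=
      Complex.ofRealCLM.contDiff.comp (Real.contDiff_exp.comp hα.neg)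
    exact (h1.mul ht).mul h2

/-! ### Laplacians, the maximum principle, and the function ρ -/

section SurfaceAnalysis

open InnerProductSpace Laplacian Filter Topology

/-! Write w for `esDensity` and Δ for the flat Laplacian. For a Hermitian connection and a local
holomorphic section s without zeros, F = (i/2) Δ log|s|² dx ∧ dy, so the vortex equation becomes Δ
log|s|² = w(|Φ|² - 4). The geometry of Σ enters through two facts: Δρ = 2w (`laplacian_esRho`), and
the area of Σ is 2π (`integral_esDensity`). By the first, log|s|² + 2ρ has Laplacian w|Φ|² ≥ 0,
hence is subharmonic.

The Higgs field is bounded: comparing |Φ|² with the barrier (P - ρ)⁻² on the disc ρ < P and letting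
P grow gives |Φ|² ≤ 16 (`IsVortex.sq_le`; the constant is not sharp). Hence F is integrable, and the
area gives deg = 2 - (1/4π) ∫ w|Φ|², which is below 2 unless Φ = 0.

The same bound limits the zeros. If Φ = (z - a)(z - b)Ψ, then |z|⁴ = ρ² e^{2ρ} shows that |Ψ|²
e^{2ρ} is O(ρ⁻²) at infinity. The logarithm of this function is subharmonic off its zeros, so the
maximum principle forces Ψ = 0 (`IsVortex.eq_zero_of_eq_mul_smul`). A nonzero Φ therefore has at
most one zero, counted with multiplicity, and either Φ or Φ/(z - a) is a global holomorphic frame.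

If Φ = 0, a frame has to be constructed. Local holomorphic frames come from solving the ∂̄-equation
with the Cauchy kernel. For such a frame σ the function log|σ|² + 2ρ is harmonic, so σ can be
rescaled holomorphically until |σ|² = e^{-2ρ}. Frames of equal norm differ by locally constant
phases, so they can be glued over convex sets (`IsFrameOn.exists_eq_const_smul`,
`exists_isFrameOn_univ`) without any further cohomological input.

A global frame s gives the isomorphism, with α = -log|s|² and ∂∂̄α = F. -/

theorem laplacian_eq_fderiv_fderiv {h : ℂ → ℝ} {x : ℂ} (hh : ContDiffAt ℝ 2 h x) :
    Δ h x = fderiv ℝ (fun y => fderiv ℝ h y 1) x 1 +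
      fderiv ℝ (fun y => fderiv ℝ h y Complex.I) x Complex.I := by
  have hd : DifferentiableAt ℝ (fderiv ℝ h) x :=
    (hh.fderiv_right (m := 1) (by norm_num)).differentiableAt (by norm_num)
  rw [laplacian_eq_iteratedFDeriv_complexPlane]
  simp only [iteratedFDeriv_two_apply]
  rw [fderiv_clm_apply hd (differentiableAt_const _), fderiv_clm_apply hd (differentiableAt_const _)]
  simp

/-- The Laplacian from explicit first partial derivatives. -/
theorem laplacian_eq_of_partials {h p q : ℂ → ℝ} {x : ℂ} {a b : ℝ} (hh : ContDiffAt ℝ 2 h x)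
    (hp : ∀ᶠ y in 𝓝 x, fderiv ℝ h y 1 = p y) (hq : ∀ᶠ y in 𝓝 x, fderiv ℝ h y Complex.I = q y)
    (ha : fderiv ℝ p x 1 = a) (hb : fderiv ℝ q x Complex.I = b) : Δ h x = a + b := by
  rw [laplacian_eq_fderiv_fderiv hh, EventuallyEq.fderiv_eq hp, EventuallyEq.fderiv_eq hq, ha, hb]

theorem laplacian_comp {g g' : ℝ → ℝ} {c : ℝ} {u : ℂ → ℝ} {x : ℂ} (hu : ContDiffAt ℝ 2 u x)
    (hgC : ContDiffAt ℝ 2 g (u x)) (hg : ∀ᶠ t in 𝓝 (u x), HasDerivAt g (g' t) t)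
    (hg' : HasDerivAt g' c (u x)) :
    Δ (fun y => g (u y)) x =
      c * (fderiv ℝ u x 1 ^ 2 + fderiv ℝ u x Complex.I ^ 2) + g' (u x) * Δ u x := by
  have hd : ∀ᶠ y in 𝓝 x, DifferentiableAt ℝ u y :=
    (hu.eventually (by simp)).mono fun y hy => hy.differentiableAt (by norm_num)
  have hdd : DifferentiableAt ℝ (fderiv ℝ u) x :=
    (hu.fderiv_right (m := 1) (by norm_num)).differentiableAt (by norm_num)
  have h1 : ∀ v : ℂ, ∀ᶠ y in 𝓝 x, fderiv ℝ (fun y => g (u y)) y v = g' (u y) * fderiv ℝ u y v := by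
    intro v
    filter_upwards [hd, hu.continuousAt.eventually hg] with y hy hgy
    have := (HasDerivAt.comp_hasFDerivAt y hgy hy.hasFDerivAt).fderiv
    rw [show (fun y => g (u y)) = g ∘ u from rfl, this]
    simp
  have h2 : ∀ v : ℂ, fderiv ℝ (fun y => g' (u y) * fderiv ℝ u y v) x v =
      c * fderiv ℝ u x v ^ 2 + g' (u x) * fderiv ℝ (fun y => fderiv ℝ u y v) x v := by
    intro v
    have e1 := HasDerivAt.comp_hasFDerivAt x hg' hd.self_of_nhds.hasFDerivAt
    have e2 : DifferentiableAt ℝ (fun y => fderiv ℝ u y v) x :=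
      hdd.clm_apply (differentiableAt_const v)
    have := (e1.mul e2.hasFDerivAt).fderiv
    rw [show (fun y => g' (u y) * fderiv ℝ u y v) = (g' ∘ u) * fun y => fderiv ℝ u y v from rfl,
      this]
    simp
    ring
  have hC : ContDiffAt ℝ 2 (fun y => g (u y)) x := hgC.comp x hu
  rw [laplacian_eq_of_partials hC (h1 1) (h1 Complex.I) (h2 1) (h2 Complex.I),
    laplacian_eq_fderiv_fderiv hu]
  ring

/-- Restrict to the line through x in direction v. A positive second derivative would make the local
maximum also a local minimum, so the restriction would be constant near 0 and its second derivative
would vanish. -/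
theorem deriv_deriv_line_nonpos_of_isLocalMax {h : ℂ → ℝ} {x : ℂ} (hh : ContDiffAt ℝ 2 h x)
    (hmax : IsLocalMax h x) (v : ℂ) : fderiv ℝ (fun y => fderiv ℝ h y v) x v ≤ 0 := by
  have hdd : DifferentiableAt ℝ (fderiv ℝ h) x :=
    (hh.fderiv_right (m := 1) (by norm_num)).differentiableAt (by norm_num)
  let l : ℝ → ℂ := fun t => x + t • v
  have hl : ∀ t, HasDerivAt l v t := fun t =>
    (((hasDerivAt_id t).smul_const v).const_add x).congr_deriv (one_smul ℝ v)
  have hl0 : l 0 = x := by simp [l]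
  have hlc : Tendsto l (𝓝 0) (𝓝 x) := by
    have := (hl 0).continuousAt.tendsto
    rwa [hl0] at this
  have hd : ∀ᶠ y in 𝓝 x, DifferentiableAt ℝ h y :=
    (hh.eventually (by simp)).mono fun y hy => hy.differentiableAt (by norm_num)
  have h1 : deriv (fun t => h (l t)) =ᶠ[𝓝 0] fun t => fderiv ℝ h (l t) v := by
    filter_upwards [hlc.eventually hd] with t ht
    exact (ht.hasFDerivAt.comp_hasDerivAt t (hl t)).deriv
  have h2 : deriv (deriv fun t => h (l t)) 0 = fderiv ℝ (fun y => fderiv ℝ h y v) x v := by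
    rw [h1.deriv_eq]
    have e : DifferentiableAt ℝ (fun y => fderiv ℝ h y v) (l 0) := by
      rw [hl0]; exact hdd.clm_apply (differentiableAt_const v)
    have := (e.hasFDerivAt.comp_hasDerivAt 0 (hl 0)).deriv
    rw [hl0] at this
    exact this
  have hm : IsLocalMax (fun t => h (l t)) 0 := by
    change ∀ᶠ t in 𝓝 0, h (l t) ≤ h (l 0)
    rw [hl0]
    exact hlc.eventually hmax
  by_contra hpos
  push Not at hpos
  have hmin := isLocalMin_of_deriv_deriv_pos (by rw [h2]; exact hpos) hm.deriv_eq_zero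
    (by
      have : ContinuousAt h (l 0) := by rw [hl0]; exact hh.continuousAt
      exact ContinuousAt.comp (f := l) (g := h) this (hl 0).continuousAt)
  have hconst : (fun t => h (l t)) =ᶠ[𝓝 0] fun _ => h (l 0) := by
    filter_upwards [hm, hmin] with t a b using le_antisymm a b
  have h3 : deriv (fun t => h (l t)) =ᶠ[𝓝 0] fun _ => 0 := by
    filter_upwards [hconst.deriv] with t ht
    rw [ht]; simp
  have h4 : deriv (deriv fun t => h (l t)) 0 = 0 := by
    rw [h3.deriv_eq]; simp
  rw [h2] at h4
  exact hpos.ne' h4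

theorem laplacian_nonpos_of_isLocalMax {h : ℂ → ℝ} {x : ℂ} (hh : ContDiffAt ℝ 2 h x)
    (hmax : IsLocalMax h x) : Δ h x ≤ 0 := by
  rw [laplacian_eq_fderiv_fderiv hh]
  exact add_nonpos (deriv_deriv_line_nonpos_of_isLocalMax hh hmax 1)
    (deriv_deriv_line_nonpos_of_isLocalMax hh hmax Complex.I)

/-- A continuous function whose value inside a ball exceeds those on the boundary sphere and is
positive has a maximum point in the ball at which the Laplacian of its logarithm is nonpositive. -/
theorem exists_laplacian_log_nonpos {G : ℂ → ℝ} {R : ℝ} {z₀ : ℂ} (hG : Continuous G)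
    (hz₀ : ‖z₀‖ < R) (hpos : 0 < G z₀) (hbd : ∀ z, ‖z‖ = R → G z < G z₀) :
    ∃ z, ‖z‖ < R ∧ G z₀ ≤ G z ∧
      (ContDiffAt ℝ 2 (fun y => Real.log (G y)) z → Δ (fun y => Real.log (G y)) z ≤ 0) := by
  obtain ⟨z, hz, hzmax⟩ := (isCompact_closedBall (0 : ℂ) R).exists_isMaxOn
    ⟨z₀, by simpa using hz₀.le⟩ hG.continuousOn
  have hge : G z₀ ≤ G z := hzmax (by simpa using hz₀.le)
  have hzR : ‖z‖ < R := by
    refine lt_of_le_of_ne (by simpa using hz) fun h => ?_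
    exact absurd (hbd z h) (not_lt.mpr hge)
  refine ⟨z, hzR, hge, fun hC => laplacian_nonpos_of_isLocalMax hC ?_⟩
  have hball : Metric.ball (0 : ℂ) R ∈ 𝓝 z := Metric.isOpen_ball.mem_nhds (by simpa using hzR)
  have hGz : 0 < G z := hpos.trans_le hge
  filter_upwards [hball, hG.continuousAt.eventually (lt_mem_nhds hGz)] with y hy hy0
  exact Real.log_le_log hy0 (hzmax (Metric.ball_subset_closedBall hy))

/-- The inverse function theorem applies to ρ ↦ ρ e^ρ, whose derivative (1 + ρ)e^ρ is nonzero for ρ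
≥ 0. Smoothness includes the origin because the inverse is composed with |z|², not with |z|. -/
theorem contDiff_esRho : ContDiff ℝ ∞ esRho := by
  rw [contDiff_iff_contDiffAt]
  intro z₀
  set a := esRho z₀ with ha
  have ha0 : 0 ≤ a := esRho_nonneg z₀
  let k : ℝ → ℝ := fun ρ => ρ * Real.exp ρ
  have hkC : ContDiffAt ℝ ∞ k a := (contDiff_id.mul Real.contDiff_exp).contDiffAt
  have hc : (1 + a) * Real.exp a ≠ 0 := by positivity
  have hk' : HasDerivAt k ((1 + a) * Real.exp a) a := by
    refine ((hasDerivAt_id a).mul (Real.hasDerivAt_exp a)).congr_deriv ?_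
    simp only [id]; ring
  let f' : ℝ ≃L[ℝ] ℝ := ContinuousLinearEquiv.unitsEquivAut ℝ (Units.mk0 _ hc)
  have hf' : HasFDerivAt k (f' : ℝ →L[ℝ] ℝ) a := by
    refine hk'.hasFDerivAt.congr_fderiv ?_
    ext; simp [f']
  have hinf : (∞ : WithTop ℕ∞) ≠ 0 := by simp
  have hg := hkC.to_localInverse hf' hinf
  have hs := hkC.hasStrictFDerivAt' hf' hinf
  have hr : ∀ᶠ t in 𝓝 (k a), k (hkC.localInverse hf' hinf t) = t := hs.eventually_right_inverse
  have hka : k a = ‖z₀‖ ^ 2 := esRho_mul_exp z₀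
  rw [hka] at hg hr
  have hn : ContDiffAt ℝ ∞ (fun z : ℂ => ‖z‖ ^ 2) z₀ := (contDiff_norm_sq ℝ).contDiffAt
  refine (hg.comp z₀ hn).congr_of_eventuallyEq ?_
  filter_upwards [hn.continuousAt.eventually hr] with z hz
  refine (esRho_existsUnique (‖z‖ ^ 2) (sq_nonneg _)).unique
    ⟨esRho_nonneg _, esRho_mul_exp _⟩ ⟨?_, hz⟩
  -- The local inverse at ρ = 0 also takes negative values, where uniqueness of ρ is not available.
  -- These are excluded since ρ e^ρ = |z|² ≥ 0.
  by_contra hneg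
  have hneg : hkC.localInverse hf' hinf (‖z‖ ^ 2) < 0 := not_le.mp hneg
  have := mul_neg_of_neg_of_pos hneg (Real.exp_pos (hkC.localInverse hf' hinf (‖z‖ ^ 2)))
  have h0 := sq_nonneg ‖z‖
  have hz' : hkC.localInverse hf' hinf (‖z‖ ^ 2) *
    Real.exp (hkC.localInverse hf' hinf (‖z‖ ^ 2)) = ‖z‖ ^ 2 := hz
  linarith

theorem hasFDerivAt_norm_sq_complex (z : ℂ) :
    HasFDerivAt (fun z : ℂ => ‖z‖ ^ 2)
      ((2 * z.re) • Complex.reCLM + (2 * z.im) • Complex.imCLM) z := by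
  have h : (fun z : ℂ => ‖z‖ ^ 2) = fun z => z.re ^ 2 + z.im ^ 2 := by
    funext z; rw [← Complex.normSq_eq_norm_sq, Complex.normSq_apply]; ring
  rw [h]
  have h1 := (Complex.reCLM.hasFDerivAt (x := z)).pow 2
  have h2 := (Complex.imCLM.hasFDerivAt (x := z)).pow 2
  refine (h1.add h2).congr_fderiv (ContinuousLinearMap.ext fun v => ?_)
  simp

theorem fderiv_esRho (z : ℂ) (v : ℂ) :
    fderiv ℝ esRho z v =
      (2 * z.re * v.re + 2 * z.im * v.im) / ((1 + esRho z) * Real.exp (esRho z)) := by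
  have hd : HasFDerivAt esRho (fderiv ℝ esRho z) z :=
    (contDiff_esRho.differentiable (by simp) z).hasFDerivAt
  have h1 := hd.mul (HasDerivAt.comp_hasFDerivAt z (Real.hasDerivAt_exp (esRho z)) hd)
  have h2 : (esRho * Real.exp ∘ esRho) = fun z => ‖z‖ ^ 2 := funext esRho_mul_exp
  rw [h2] at h1
  have h3 := congrArg (fun L : ℂ →L[ℝ] ℝ => L v) (h1.unique (hasFDerivAt_norm_sq_complex z))
  simp at h3
  have h0 := esRho_nonneg z
  have he := Real.exp_pos (esRho z)
  rw [eq_div_iff (by positivity)]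
  linarith

theorem grad_esRho_sq (z : ℂ) : fderiv ℝ esRho z 1 ^ 2 + fderiv ℝ esRho z Complex.I ^ 2 =
    2 * esDensity z * (esRho z * (1 + esRho z)) := by
  have h0 := esRho_nonneg z
  have he := Real.exp_pos (esRho z)
  have hn : z.re ^ 2 + z.im ^ 2 = esRho z * Real.exp (esRho z) := by
    rw [esRho_mul_exp, ← Complex.normSq_eq_norm_sq, Complex.normSq_apply]; ring
  rw [fderiv_esRho, fderiv_esRho, esDensity]
  have h1 : (1 + esRho z) ≠ 0 := by positivity
  simp
  field_simp
  linear_combination hn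

/-- The Laplacian of ρ for the metric of Σ is the constant 2. Thus 2ρ is a potential that absorbs
the constant 4 of the vortex equation. -/
theorem laplacian_esRho (z : ℂ) : Δ esRho z = 2 * esDensity z := by
  have h0 := esRho_nonneg z
  have he := Real.exp_pos (esRho z)
  have hd : HasFDerivAt esRho (fderiv ℝ esRho z) z :=
    (contDiff_esRho.differentiable (by simp) z).hasFDerivAt
  have hden : HasFDerivAt (fun y => (1 + esRho y) * Real.exp (esRho y))
      (((2 + esRho z) * Real.exp (esRho z)) • fderiv ℝ esRho z) z := by
    have := (hd.const_add 1).mul (HasDerivAt.comp_hasFDerivAt z (Real.hasDerivAt_exp (esRho z)) hd)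
    refine this.congr_fderiv ?_
    ext <;> simp
    all_goals ring
  have hne : (1 + esRho z) * Real.exp (esRho z) ≠ 0 := by positivity
  have hinv := HasDerivAt.comp_hasFDerivAt z (hasDerivAt_inv hne) hden
  have hx := ((Complex.reCLM.hasFDerivAt (x := z)).const_mul 2).mul hinv
  have hy := ((Complex.imCLM.hasFDerivAt (x := z)).const_mul 2).mul hinv
  rw [laplacian_eq_of_partials
    (p := (fun y => 2 * Complex.reCLM y) * Inv.inv ∘ fun y => (1 + esRho y) * Real.exp (esRho y))
    (q := (fun y => 2 * Complex.imCLM y) * Inv.inv ∘ fun y => (1 + esRho y) * Real.exp (esRho y))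
    (contDiff_esRho.of_le ENat.LEInfty.out).contDiffAt
    (Eventually.of_forall fun y => ?_) (Eventually.of_forall fun y => ?_) rfl rfl]
  · rw [hx.fderiv, hy.fderiv]
    have hn : z.re ^ 2 + z.im ^ 2 = esRho z * Real.exp (esRho z) := by
      rw [esRho_mul_exp, ← Complex.normSq_eq_norm_sq, Complex.normSq_apply]; ring
    have h1 : (1 + esRho z) ≠ 0 := by positivity
    simp [fderiv_esRho, esDensity]
    field_simp
    linear_combination (-2 * (2 + esRho z)) * hn
  · rw [fderiv_esRho]; simp [div_eq_mul_inv]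
  · rw [fderiv_esRho]; simp [div_eq_mul_inv]

theorem laplacian_comp_esRho {g g' : ℝ → ℝ} {c : ℝ} (z : ℂ)
    (hgC : ContDiffAt ℝ 2 g (esRho z)) (hg : ∀ᶠ t in 𝓝 (esRho z), HasDerivAt g (g' t) t)
    (hg' : HasDerivAt g' c (esRho z)) :
    Δ (fun y => g (esRho y)) z =
      esDensity z * (2 * esRho z * (1 + esRho z) * c + 2 * g' (esRho z)) := by
  rw [laplacian_comp (contDiff_esRho.of_le ENat.LEInfty.out).contDiffAt hgC hg hg',
    grad_esRho_sq, laplacian_esRho]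
  ring

theorem laplacian_norm_sq (c : ℝ) (z : ℂ) : Δ (fun y : ℂ => c * ‖y‖ ^ 2) z = 4 * c := by
  have hx := (Complex.reCLM.hasFDerivAt (x := z)).const_mul (2 * c)
  have hy := (Complex.imCLM.hasFDerivAt (x := z)).const_mul (2 * c)
  rw [laplacian_eq_of_partials (p := fun y => 2 * c * Complex.reCLM y)
    (q := fun y => 2 * c * Complex.imCLM y) (contDiff_const.mul (contDiff_norm_sq ℝ)).contDiffAt
    (Eventually.of_forall fun y => ?_) (Eventually.of_forall fun y => ?_) rfl rfl]
  · rw [hx.fderiv, hy.fderiv]; simp; ring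
  · rw [((hasFDerivAt_norm_sq_complex y).const_mul c).fderiv]; simp; ring
  · rw [((hasFDerivAt_norm_sq_complex y).const_mul c).fderiv]; simp; ring

theorem esDensity_pos (z : ℂ) : 0 < esDensity z := by
  have h0 := esRho_nonneg z
  have he := Real.exp_pos (esRho z)
  rw [esDensity]; positivity

theorem contDiff_esDensity : ContDiff ℝ ∞ esDensity := by
  refine contDiff_const.div (((contDiff_const.add contDiff_esRho).pow 3).mul
    (Real.contDiff_exp.comp contDiff_esRho)) fun z => ?_
  have h0 := esRho_nonneg z
  have he := Real.exp_pos (esRho z)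
  positivity

end SurfaceAnalysis

/-! ### The area of the surface -/

section SurfaceArea

open Filter Topology MeasureTheory Set

theorem mul_exp_lt_mul_exp_iff {a b : ℝ} (ha : 0 ≤ a) (hb : 0 ≤ b) :
    a * Real.exp a < b * Real.exp b ↔ a < b := by
  have hmono : StrictMonoOn (fun t : ℝ => t * Real.exp t) (Ici 0) := by
    intro s hs t _ hst
    have h1 := Real.exp_lt_exp.mpr hst
    have h2 := Real.exp_pos s
    have hs' : 0 ≤ s := hs
    change s * Real.exp s < t * Real.exp t
    nlinarith
  exact hmono.lt_iff_lt ha hb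

theorem esRho_lt_iff {P : ℝ} (hP : 0 ≤ P) (z : ℂ) : esRho z < P ↔ ‖z‖ ^ 2 < P * Real.exp P := by
  rw [← esRho_mul_exp, mul_exp_lt_mul_exp_iff (esRho_nonneg z) hP]

theorem esRho_eq_of_norm_sq {P : ℝ} (hP : 0 ≤ P) {z : ℂ} (h : ‖z‖ ^ 2 = P * Real.exp P) :
    esRho z = P :=
  (esRho_existsUnique (‖z‖ ^ 2) (sq_nonneg _)).unique
    ⟨esRho_nonneg _, esRho_mul_exp _⟩ ⟨hP, h.symm⟩

theorem tendsto_esRho : Tendsto esRho (cocompact ℂ) atTop := by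
  refine tendsto_atTop.mpr fun b => ?_
  have h1 : ∀ᶠ z : ℂ in cocompact ℂ, max b 0 * Real.exp (max b 0) + 1 ≤ ‖z‖ :=
    (tendsto_norm_cocompact_atTop).eventually (eventually_ge_atTop _)
  filter_upwards [h1] with z hz
  have hm : 0 ≤ max b 0 * Real.exp (max b 0) := by positivity
  refine (le_max_left b 0).trans (not_lt.mp fun h => ?_)
  rw [esRho_lt_iff (le_max_right b 0)] at h
  nlinarith

theorem esRho_ofReal_norm (z : ℂ) : esRho (‖z‖ : ℂ) = esRho z :=
  esRho_eq_of_norm_sq (esRho_nonneg z) (by rw [esRho_mul_exp]; simp)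

theorem esDensity_ofReal_norm (z : ℂ) : esDensity (‖z‖ : ℂ) = esDensity z := by
  rw [esDensity, esDensity, esRho_ofReal_norm]

/-- The integrand is the derivative of -1/(1 + ρ), which runs from -1 to 0. -/
theorem integral_mul_esDensity_Ioi : ∫ r in Ioi (0 : ℝ), r * esDensity r = 1 := by
  have hρ : ∀ r : ℝ, HasDerivAt (fun r : ℝ => esRho r)
      (2 * r / ((1 + esRho r) * Real.exp (esRho r))) r := by
    intro r
    have h := (contDiff_esRho.differentiable (by simp) (r : ℂ)).hasFDerivAt
    refine (h.comp_hasDerivAt r Complex.ofRealCLM.hasDerivAt).congr_deriv ?_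
    rw [fderiv_esRho]; simp
  have hd : ∀ r : ℝ, HasDerivAt (fun r : ℝ => -(1 + esRho r)⁻¹) (r * esDensity r) r := by
    intro r
    have h0 := esRho_nonneg r
    have h1 : 1 + esRho r ≠ 0 := by positivity
    refine ((hρ r).const_add 1 |>.inv h1).neg.congr_deriv ?_
    rw [esDensity]
    field_simp
  have ht : Tendsto (fun r : ℝ => -(1 + esRho r)⁻¹) atTop (𝓝 0) := by
    have h1 : Tendsto (fun r : ℝ => (r : ℂ)) atTop (cocompact ℂ) := by
      rw [← Metric.cobounded_eq_cocompact, ← tendsto_norm_atTop_iff_cobounded]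
      simpa using tendsto_abs_atTop_atTop
    have h2 := tendsto_inv_atTop_zero.comp
      (tendsto_atTop_add_const_left _ (1 : ℝ) (tendsto_esRho.comp h1))
    simpa using h2.neg
  rw [integral_Ioi_of_hasDerivAt_of_nonneg (hd 0).continuousAt.continuousWithinAt
    (fun r _ => hd r) (fun r hr => mul_nonneg (le_of_lt hr) (esDensity_pos _).le) ht]
  have : esRho ((0 : ℝ) : ℂ) = 0 := esRho_eq_of_norm_sq le_rfl (by simp)
  simp only [this]
  norm_num

theorem integral_esDensity : ∫ z : ℂ, esDensity z = 2 * Real.pi := by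
  rw [← Complex.integral_comp_polarCoord_symm]
  have h1 : ∫ p in polarCoord.target, p.1 • esDensity (Complex.polarCoord.symm p) =
      ∫ p in Ioi (0 : ℝ) ×ˢ Ioo (-Real.pi) Real.pi, (p.1 * esDensity p.1) * (1 : ℝ) := by
    refine setIntegral_congr_fun polarCoord.open_target.measurableSet fun p hp => ?_
    have hp0 : 0 < p.1 := hp.1
    simp only [smul_eq_mul, mul_one]
    rw [← esDensity_ofReal_norm (Complex.polarCoord.symm p), Complex.norm_polarCoord_symm,
      abs_of_pos hp0]
  rw [h1, Measure.volume_eq_prod, setIntegral_prod_mul (fun r : ℝ => r * esDensity r)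
    (fun _ : ℝ => (1 : ℝ)), integral_mul_esDensity_Ioi]
  simp
  rw [max_eq_left (by positivity)]
  ring

theorem integrable_esDensity : Integrable esDensity :=
  -- The Bochner integral of a non-integrable function is 0 by convention, so the value 2π proves
  -- integrability.
  Integrable.of_integral_ne_zero (by rw [integral_esDensity]; positivity)

end SurfaceArea

/-! ### The ∂̄-equation with compactly supported right-hand side -/

section CauchyTransform

open Filter Topology MeasureTheory Set

theorem integrableOn_polar_of_vanishing {F : ℝ × ℝ → ℂ} (hF : Continuous F) {R : ℝ}
    (hR : ∀ p : ℝ × ℝ, R ≤ p.1 → F p = 0) :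
    IntegrableOn F (Ioi (0 : ℝ) ×ˢ Ioo (-Real.pi) Real.pi) := by
  have h1 : IntegrableOn F (Icc (0 : ℝ) R ×ˢ Icc (-Real.pi) Real.pi) :=
    hF.continuousOn.integrableOn_compact (isCompact_Icc.prod isCompact_Icc)
  refine h1.of_forall_sdiff_eq_zero (measurableSet_Ioi.prod measurableSet_Ioo) ?_
  rintro p ⟨⟨hp1, hp2⟩, hp⟩
  refine hR p (le_of_not_ge fun h => hp ⟨⟨le_of_lt hp1, h⟩, Ioo_subset_Icc_self hp2⟩)

/-- The Cauchy–Pompeiu formula for compactly supported functions. -/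
theorem integral_inv_mul_wirtingerZbar {G : ℂ → ℂ} (hG : ContDiff ℝ ∞ G)
    (hc : HasCompactSupport G) :
    ∫ t : ℂ, (Real.pi * t)⁻¹ * wirtingerZbar G t = -G 0 := by
  obtain ⟨R, hR⟩ : ∃ R : ℝ, ∀ z : ℂ, R ≤ ‖z‖ → z ∉ tsupport G := by
    obtain ⟨R, hR⟩ := hc.isCompact.isBounded.subset_ball 0
    exact ⟨R, fun z hz h => absurd (by simpa using hR h) (not_lt.mpr hz)⟩
  have hG0 : ∀ z : ℂ, R ≤ ‖z‖ → G z = 0 := fun z hz => image_eq_zero_of_notMem_tsupport (hR z hz)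
  have hG0' : ∀ z : ℂ, R ≤ ‖z‖ → fderiv ℝ G z = 0 := fun z hz => by
    by_contra h
    exact hR z hz (support_fderiv_subset ℝ h)
  have hdc : Continuous (fderiv ℝ G) := hG.continuous_fderiv (by simp)
  have hGd : ∀ z, HasFDerivAt G (fderiv ℝ G z) z := fun z =>
    (hG.differentiable (by simp) z).hasFDerivAt
  let e : ℝ → ℂ := fun θ => Complex.exp (θ * Complex.I)
  have hec : Continuous e := by fun_prop
  have hen : ∀ θ, ‖e θ‖ = 1 := fun θ => Complex.norm_exp_ofReal_mul_I θ
  -- A is the radial derivative ∂_r G and B is r⁻¹ ∂_θ G. Since ∂/∂z̄ = (e^{iθ}/2)(∂_r + i r⁻¹ ∂_θ),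
  -- the Jacobian r cancels the singularity of the kernel and leaves (A + iB)/2π. Integrating A in r
  -- gives -G(0), and integrating B over a full period in θ gives 0.
  let A : ℝ × ℝ → ℂ := fun p => fderiv ℝ G (p.1 * e p.2) (e p.2)
  let B : ℝ × ℝ → ℂ := fun p => fderiv ℝ G (p.1 * e p.2) (Complex.I * e p.2)
  have hpc : Continuous fun p : ℝ × ℝ => (p.1 : ℂ) * e p.2 := by fun_prop
  have hAc : Continuous A := (hdc.comp hpc).clm_apply (hec.comp continuous_snd)
  have hBc : Continuous B :=
    (hdc.comp hpc).clm_apply (continuous_const.mul (hec.comp continuous_snd))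
  have hnp : ∀ p : ℝ × ℝ, R ≤ p.1 → R ≤ ‖(p.1 : ℂ) * e p.2‖ := fun p hp => by
    rw [norm_mul, hen, mul_one, Complex.norm_real]
    exact hp.trans (le_abs_self _)
  have hAi := integrableOn_polar_of_vanishing hAc (R := R) fun p hp => by
    simp only [A]; rw [hG0' _ (hnp p hp)]; simp
  have hBi := integrableOn_polar_of_vanishing hBc (R := R) fun p hp => by
    simp only [B]; rw [hG0' _ (hnp p hp)]; simp
  have hpolar : ∀ p : ℝ × ℝ, Complex.polarCoord.symm p = p.1 * e p.2 := fun p => by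
    rw [Complex.polarCoord_symm_apply]
    simp only [e]
    rw [Complex.exp_mul_I]
    push_cast
    rfl
  have hint : ∀ p ∈ Ioi (0 : ℝ) ×ˢ Ioo (-Real.pi) Real.pi,
      p.1 • ((Real.pi * Complex.polarCoord.symm p)⁻¹ *
        wirtingerZbar G (Complex.polarCoord.symm p)) =
      (2 * Real.pi : ℂ)⁻¹ * (A p + Complex.I * B p) := by
    intro p hp
    have hp0 : (p.1 : ℂ) ≠ 0 := by exact_mod_cast (show (0 : ℝ) < p.1 from hp.1).ne'
    have he0 : e p.2 ≠ 0 := Complex.exp_ne_zero _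
    have hpi : (Real.pi : ℂ) ≠ 0 := by exact_mod_cast Real.pi_ne_zero
    have hL : ∀ (L : ℂ →L[ℝ] ℂ) (w : ℂ), L w = w.re * L 1 + w.im * L Complex.I := by
      intro L w
      have h : w = w.re • (1 : ℂ) + w.im • Complex.I := by simp
      conv_lhs => rw [h]
      rw [map_add, map_smul, map_smul]
      simp
    have hcs : ((e p.2).re : ℂ) ^ 2 + ((e p.2).im : ℂ) ^ 2 = 1 := by
      have := Complex.normSq_eq_norm_sq (e p.2)
      rw [hen, Complex.normSq_apply] at this
      have h2 : (e p.2).re ^ 2 + (e p.2).im ^ 2 = 1 := by linarith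
      exact_mod_cast h2
    have hAB : A p + Complex.I * B p = (e p.2)⁻¹ * (2 * wirtingerZbar G (p.1 * e p.2)) := by
      rw [eq_inv_mul_iff_mul_eq₀ he0]
      simp only [A, B, wirtingerZbar]
      rw [hL _ (e p.2), hL _ (Complex.I * e p.2)]
      have he : e p.2 = (e p.2).re + (e p.2).im * Complex.I := (Complex.re_add_im _).symm
      generalize hgx : fderiv ℝ G (p.1 * e p.2) 1 = gx
      generalize hgy : fderiv ℝ G (p.1 * e p.2) Complex.I = gy
      have h1 : (Complex.I * e p.2).re = -(e p.2).im := by simp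
      have h2 : (Complex.I * e p.2).im = (e p.2).re := by simp
      rw [h1, h2]
      conv_lhs => rw [he]
      simp only [Complex.add_re, Complex.add_im, Complex.mul_re, Complex.mul_im, Complex.ofReal_re,
        Complex.ofReal_im, Complex.I_re, Complex.I_im]
      push_cast
      have hI := Complex.I_sq
      linear_combination (gx + Complex.I * gy) * hcs +
        (-((e p.2).im : ℂ) ^ 2 * gx + ((e p.2).im : ℂ) * (e p.2).re * gy) * hI
    rw [hAB, hpolar, Complex.real_smul]
    field_simp
  have hA : ∫ p in Ioi (0 : ℝ) ×ˢ Ioo (-Real.pi) Real.pi, A p = -(2 * Real.pi * G 0) := by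
    rw [Measure.volume_eq_prod] at hAi ⊢
    rw [← setIntegral_prod_swap, setIntegral_prod (fun z : ℝ × ℝ => A z.swap) hAi.swap]
    have h1 : ∀ θ : ℝ, ∫ r in Ioi (0 : ℝ), A (r, θ) = -G 0 := by
      intro θ
      have hd : ∀ r : ℝ, HasDerivAt (fun r : ℝ => G (r * e θ)) (A (r, θ)) r := fun r => by
        have hl : HasDerivAt (fun r : ℝ => (r : ℂ) * e θ) (e θ) r := by
          simpa using (Complex.ofRealCLM.hasDerivAt (x := r)).mul_const (e θ)
        exact (hGd _).comp_hasDerivAt r hl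
      have hz : ∀ r ∈ Ioi R, A (r, θ) = 0 := fun r hr => by
        simp only [A]; rw [hG0' _ (hnp (r, θ) (le_of_lt hr))]; simp
      have hi : IntegrableOn (fun r => A (r, θ)) (Ioi 0) := by
        have h1 : IntegrableOn (fun r => A (r, θ)) (Icc 0 R) :=
          (hAc.comp (by fun_prop : Continuous fun r : ℝ => (r, θ))).continuousOn.integrableOn_Icc
        refine h1.of_forall_sdiff_eq_zero measurableSet_Ioi ?_
        rintro r ⟨hr1, hr2⟩
        exact hz r (lt_of_not_ge fun h => hr2 ⟨le_of_lt hr1, h⟩)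
      have ht : Tendsto (fun r : ℝ => G (r * e θ)) atTop (𝓝 0) :=
        tendsto_const_nhds.congr' (by
          filter_upwards [eventually_ge_atTop R] with r hr
          exact (hG0 _ (hnp (r, θ) hr)).symm)
      rw [integral_Ioi_of_hasDerivAt_of_tendsto (hd 0).continuousAt.continuousWithinAt
        (fun r _ => hd r) hi ht]
      simp
    simp only [Prod.swap_prod_mk]
    rw [setIntegral_congr_fun measurableSet_Ioo fun θ _ => h1 θ, setIntegral_const,
      Real.volume_real_Ioo_of_le (by linarith [Real.pi_pos]), Complex.real_smul]
    push_cast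
    ring
  have hB : ∫ p in Ioi (0 : ℝ) ×ˢ Ioo (-Real.pi) Real.pi, B p = 0 := by
    rw [Measure.volume_eq_prod] at hBi ⊢
    rw [setIntegral_prod _ hBi]
    refine setIntegral_eq_zero_of_forall_eq_zero fun r hr => ?_
    have hr0 : (r : ℂ) ≠ 0 := by exact_mod_cast (show (0 : ℝ) < r from hr).ne'
    have hd : ∀ θ : ℝ, HasDerivAt (fun θ : ℝ => (r : ℂ)⁻¹ * G (r * e θ)) (B (r, θ)) θ := fun θ => by
      have he : HasDerivAt e (e θ * Complex.I) θ := by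
        simpa using ((Complex.ofRealCLM.hasDerivAt (x := θ)).mul_const Complex.I).cexp
      refine (((hGd _).comp_hasDerivAt θ (he.const_mul (r : ℂ))).const_mul _).congr_deriv ?_
      have : (r : ℂ) * (e θ * Complex.I) = r • (Complex.I * e θ) := by
        rw [Complex.real_smul]; ring
      simp only [this, map_smul, B]
      rw [Complex.real_smul]
      field_simp
    rw [← integral_Ioc_eq_integral_Ioo, ← intervalIntegral.integral_of_le (by linarith [Real.pi_pos]),
      intervalIntegral.integral_eq_sub_of_hasDerivAt (fun θ _ => hd θ)
        ((hBc.comp (by fun_prop : Continuous fun θ : ℝ => (r, θ))).intervalIntegrable _ _)]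
    have : e Real.pi = e (-Real.pi) := by
      simp only [e]
      push_cast
      rw [neg_mul, Complex.exp_neg, Complex.exp_pi_mul_I]
      norm_num
    rw [this, sub_self]
  rw [← Complex.integral_comp_polarCoord_symm]
  change ∫ p in Ioi (0 : ℝ) ×ˢ Ioo (-Real.pi) Real.pi, _ = _
  rw [setIntegral_congr_fun (measurableSet_Ioi.prod measurableSet_Ioo) hint, integral_const_mul,
    integral_add hAi (hBi.const_mul Complex.I), integral_const_mul, hA, hB]
  have hpi : (Real.pi : ℂ) ≠ 0 := by exact_mod_cast Real.pi_ne_zero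
  field_simp
  ring

/-- The equation `∂u/∂z̄ = g` is solvable for smooth compactly supported `g`. -/
theorem exists_wirtingerZbar_eq {g : ℂ → ℂ} (hg : ContDiff ℝ ∞ g) (hc : HasCompactSupport g) :
    ∃ u : ℂ → ℂ, ContDiff ℝ ∞ u ∧ ∀ z, wirtingerZbar u z = g z := by
  -- The solution is the convolution of g with the fundamental solution 1/(πt) of ∂/∂z̄. The
  -- derivatives fall on g, and the Cauchy–Pompeiu formula for t ↦ g(z - t) gives the value; the
  -- sign from the reflection cancels the sign in that formula.
  let k : ℂ → ℂ := fun t => (Real.pi * t)⁻¹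
  have hk : LocallyIntegrable k := by
    refine locallyIntegrable_of_norm_le_rpow (C := Real.pi⁻¹) (α := 1) (by simp) (by simp) ?_ ?_
    · refine Eventually.of_forall fun t => ?_
      simp only [k, norm_inv, norm_mul, Complex.norm_real, Real.norm_eq_abs,
        abs_of_pos Real.pi_pos, mul_inv, Real.rpow_neg_one, le_refl]
    · exact (measurable_const.mul measurable_id).inv.aestronglyMeasurable
  let L : ℂ →L[ℝ] ℂ →L[ℝ] ℂ := ContinuousLinearMap.mul ℝ ℂ
  let u : ℂ → ℂ := convolution k g L
  refine ⟨u, hc.contDiff_convolution_right L hk hg, fun z => ?_⟩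
  have hD := hc.hasFDerivAt_convolution_right L hk (hg.of_le (by simp)) z
  have hcf : HasCompactSupport (fderiv ℝ g) := hc.fderiv ℝ
  have hdc : Continuous (fderiv ℝ g) := hg.continuous_fderiv (by simp)
  have hce : ConvolutionExists k (fderiv ℝ g) (L.precompR ℂ) :=
    hcf.convolutionExists_right _ hk hdc
  have hv : ∀ v : ℂ, fderiv ℝ u z v = ∫ t, k t * fderiv ℝ g (z - t) v := by
    intro v
    rw [hD.fderiv, convolution, ContinuousLinearMap.integral_apply (hce z)]
    rfl
  have hi : ∀ v : ℂ, Integrable fun t => k t * fderiv ℝ g (z - t) v := fun v =>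
    (hce z).apply_continuousLinearMap v
  have hGC : ContDiff ℝ ∞ fun t => g (z - t) := hg.comp (contDiff_const.sub contDiff_id)
  have hGc : HasCompactSupport fun t => g (z - t) :=
    hc.comp_homeomorph (Homeomorph.subLeft z)
  have hGd : ∀ t v, fderiv ℝ (fun t => g (z - t)) t v = -fderiv ℝ g (z - t) v := by
    intro t v
    have h1 : HasFDerivAt (fun t : ℂ => z - t) (-ContinuousLinearMap.id ℝ ℂ) t :=
      (hasFDerivAt_id t).const_sub z
    have h2 := ((hg.differentiable (by simp) (z - t)).hasFDerivAt.comp t h1).fderiv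
    rw [show (fun t => g (z - t)) = g ∘ HSub.hSub z from rfl, h2]
    simp
  have key := integral_inv_mul_wirtingerZbar hGC hGc
  simp only [sub_zero] at key
  rw [wirtingerZbar, hv, hv, ← integral_const_mul, ← integral_add (hi 1) ((hi _).const_mul _),
    ← integral_const_mul, ← neg_neg (g z), ← key, ← integral_neg]
  refine integral_congr_ae (Eventually.of_forall fun t => ?_)
  simp only [wirtingerZbar, hGd, k]
  ring

end CauchyTransform

/-! ### Cut-off functions and (0,1)-parts -/

section CutOff

open Filter Topology

/-- Connections act only on globally defined sections. A cut-off equal to 1 on a whole neighbourhood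
of a replaces local coefficients by global ones without changing any derivative at a. -/
theorem exists_cutoff {a : ℂ} {U : Set ℂ} (hU : U ∈ 𝓝 a) :
    ∃ b : ℂ → ℂ, ContDiff ℝ ∞ b ∧ (∀ᶠ y in 𝓝 a, b y = 1) ∧ HasCompactSupport b ∧
      tsupport b ⊆ U := by
  obtain ⟨r, hr, hrs⟩ := Metric.mem_nhds_iff.mp hU
  let b : ContDiffBump a := ⟨r / 4, r / 2, by positivity, by linarith⟩
  have hsupp : Function.support (fun y => ((b y : ℝ) : ℂ)) ⊆ Function.support b := fun y hy => by
    simp only [Function.mem_support, ne_eq, Complex.ofReal_eq_zero] at hy ⊢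
    exact hy
  refine ⟨fun y => ((b y : ℝ) : ℂ), Complex.ofRealCLM.contDiff.comp b.contDiff, ?_,
    b.hasCompactSupport.mono hsupp, (closure_mono hsupp).trans ?_⟩
  · filter_upwards [b.eventuallyEq_one] with y hy
    rw [hy]; simp
  · change tsupport b ⊆ U
    rw [b.tsupport_eq]
    exact (Metric.closedBall_subset_ball (by change r / 2 < r; linarith)).trans hrs

theorem contDiff_cutoff_mul {b g : ℂ → ℂ} (hb : ContDiff ℝ ∞ b)
    (hg : ∀ y ∈ tsupport b, ContDiffAt ℝ ∞ g y) : ContDiff ℝ ∞ fun y => b y * g y := by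
  rw [contDiff_iff_contDiffAt]
  intro y
  by_cases hy : y ∈ tsupport b
  · exact hb.contDiffAt.mul (hg y hy)
  · refine (contDiffAt_const (c := (0 : ℂ))).congr_of_eventuallyEq ?_
    filter_upwards [notMem_tsupport_iff_eventuallyEq.mp hy] with z hz
    simp [hz]

theorem zeroOnePart_apply {V : Type*} [AddCommGroup V] [Module ℂ V] (L : ℂ →ₗ[ℝ] V) (v : ℂ) :
    zeroOnePart L v = (1 / 2 : ℂ) • (L v + Complex.I • L (Complex.I * v)) := rfl

/-- A conjugate-linear form on ℂ is determined by its value at 1, so a single Cauchy–Riemann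
equation suffices. -/
theorem zeroOnePart_eq_zero_iff {V : Type*} [AddCommGroup V] [Module ℂ V] (L : ℂ →ₗ[ℝ] V) :
    zeroOnePart L = 0 ↔ L Complex.I = Complex.I • L 1 := by
  have h1 : zeroOnePart L 1 = (1 / 2 : ℂ) • (L 1 + Complex.I • L Complex.I) := by
    rw [zeroOnePart_apply, mul_one]
  constructor
  · intro h
    rw [h] at h1
    have h2 : L 1 + Complex.I • L Complex.I = 0 := by
      have := h1.symm
      rw [LinearMap.zero_apply] at this
      exact (smul_eq_zero.mp this).resolve_left (by norm_num)
    have h3 : Complex.I • (L 1 + Complex.I • L Complex.I) = 0 := by rw [h2, smul_zero]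
    rw [smul_add, smul_smul, Complex.I_mul_I, neg_one_smul] at h3
    exact (add_neg_eq_zero.mp h3).symm
  · intro h
    rw [h, smul_smul, Complex.I_mul_I, neg_one_smul, add_neg_cancel, smul_zero] at h1
    refine LinearMap.ext fun v => ?_
    rw [← mul_one v, ← smul_eq_mul, map_smulₛₗ, h1, smul_zero, LinearMap.zero_apply]

end CutOff

/-! ### Sections, their norms, and local holomorphic frames -/

section Sections

open Filter Topology

universe u

variable {E : ℂ → Type u} [TopologicalSpace (TotalSpace ℂ E)]
  [∀ x, AddCommGroup (E x)] [∀ x, Module ℂ (E x)] [∀ x, TopologicalSpace (E x)]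
  [FiberBundle ℂ E]

theorem exists_smul_eq_of_ne_zero [VectorBundle ℂ ℂ E] {x : ℂ} {a : E x} (ha : a ≠ 0) (b : E x) :
    ∃ c : ℂ, b = c • a := by
  let L := (trivializationAt ℂ E x).continuousLinearEquivAt ℂ x (mem_baseSet_trivializationAt ℂ E x)
  have hL : L a ≠ 0 := by simpa using ha
  refine ⟨L b / L a, L.injective ?_⟩
  rw [map_smul, smul_eq_mul, div_mul_cancel₀ _ hL]

theorem exists_fiber_ne_zero [VectorBundle ℂ ℂ E] (x : ℂ) : ∃ a : E x, a ≠ 0 := by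
  let L := (trivializationAt ℂ E x).continuousLinearEquivAt ℂ x (mem_baseSet_trivializationAt ℂ E x)
  refine ⟨L.symm 1, by simp⟩

theorem IsSmoothSection.of_eventuallyEq {s : ∀ x, E x}
    (h : ∀ x, ∃ t : ∀ y, E y, IsSmoothSection t ∧ ∀ᶠ y in 𝓝 x, s y = t y) : IsSmoothSection s := by
  intro e he x hx
  obtain ⟨t, ht, hst⟩ := h x
  refine (((ht e).contDiffAt (e.open_baseSet.mem_nhds hx)).congr_of_eventuallyEq
    ?_).contDiffWithinAt
  filter_upwards [hst] with y hy
  rw [hy]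

theorem IsSmoothSection.add [VectorBundle ℂ ℂ E] {s t : ∀ x, E x} (hs : IsSmoothSection s)
    (ht : IsSmoothSection t) : IsSmoothSection fun x => s x + t x := by
  intro e he
  refine ((hs e).add (ht e)).congr fun x hx => ?_
  exact (e.linear ℂ hx).map_add (s x) (t x)

namespace HermitianStructure

variable (H : HermitianStructure E)

/-- The pointwise squared norm of a section. -/
noncomputable def sq (s : ∀ x, E x) (x : ℂ) : ℝ := (H.inner x (s x) (s x)).re

/-- The coefficient function of `s` with respect to `σ`. -/
noncomputable def coeff (σ s : ∀ x, E x) (x : ℂ) : ℂ :=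
  H.inner x (σ x) (s x) / H.inner x (σ x) (σ x)

theorem inner_self (s : ∀ x, E x) (x : ℂ) : H.inner x (s x) (s x) = (H.sq s x : ℂ) :=
  (Complex.conj_eq_iff_re.mp (H.conj_symm x (s x) (s x))).symm

theorem sq_pos {s : ∀ x, E x} {x : ℂ} (h : s x ≠ 0) : 0 < H.sq s x := H.pos x _ h

theorem inner_self_ne_zero {s : ∀ x, E x} {x : ℂ} (h : s x ≠ 0) : H.inner x (s x) (s x) ≠ 0 := by
  rw [H.inner_self]; exact_mod_cast (H.sq_pos h).ne'

theorem sq_eq_zero {s : ∀ x, E x} {x : ℂ} (h : s x = 0) : H.sq s x = 0 := by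
  simp [sq, h]

theorem sq_nonneg (s : ∀ x, E x) (x : ℂ) : 0 ≤ H.sq s x := by
  by_cases h : s x = 0
  · rw [H.sq_eq_zero h]
  · exact (H.sq_pos h).le

theorem ne_zero_of_sq_pos {s : ∀ x, E x} {x : ℂ} (h : 0 < H.sq s x) : s x ≠ 0 :=
  fun h0 => h.ne' (H.sq_eq_zero h0)

theorem sq_of_eq_smul {s t : ∀ x, E x} {x c : ℂ} (h : s x = c • t x) :
    H.sq s x = ‖c‖ ^ 2 * H.sq t x := by
  have h1 := H.inner_self s x
  rw [h, map_smul, LinearMap.map_smulₛₗ, LinearMap.smul_apply, H.inner_self t x, smul_eq_mul,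
    smul_eq_mul, ← mul_assoc, Complex.mul_conj, Complex.normSq_eq_norm_sq] at h1
  exact_mod_cast h1.symm

theorem contDiff_sq {s : ∀ x, E x} (hs : IsSmoothSection s) : ContDiff ℝ ∞ (H.sq s) :=
  Complex.reCLM.contDiff.comp (H.smooth s s hs hs)

theorem contDiffAt_log_sq {s : ∀ x, E x} (hs : IsSmoothSection s) {x : ℂ} (hx : s x ≠ 0) :
    ContDiffAt ℝ ∞ (fun y => Real.log (H.sq s y)) x :=
  (H.contDiff_sq hs).contDiffAt.log (H.sq_pos hx).ne'

theorem eventually_ne_zero (H : HermitianStructure E) {s : ∀ x, E x} (hs : IsSmoothSection s) {x : ℂ} (hx : s x ≠ 0) :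
    ∀ᶠ y in 𝓝 x, s y ≠ 0 := by
  filter_upwards [(H.contDiff_sq hs).continuous.continuousAt.eventually
    (lt_mem_nhds (H.sq_pos hx))] with y hy using H.ne_zero_of_sq_pos hy

theorem coeff_smul [VectorBundle ℂ ℂ E] {σ : ∀ x, E x} (s : ∀ x, E x) {x : ℂ} (hx : σ x ≠ 0) :
    H.coeff σ s x • σ x = s x := by
  obtain ⟨c, hc⟩ := exists_smul_eq_of_ne_zero hx (s x)
  rw [coeff, hc, map_smul, smul_eq_mul, mul_div_cancel_right₀ _ (H.inner_self_ne_zero hx)]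

theorem contDiffAt_coeff {σ s : ∀ x, E x} (hσ : IsSmoothSection σ) (hs : IsSmoothSection s)
    {x : ℂ} (hx : σ x ≠ 0) : ContDiffAt ℝ ∞ (H.coeff σ s) x := by
  have h := (H.smooth σ s hσ hs).contDiffAt.mul
    ((H.smooth σ σ hσ hσ).contDiffAt.inv (H.inner_self_ne_zero hx))
  exact h.congr_of_eventuallyEq (Eventually.of_forall fun y => div_eq_mul_inv _ _)

end HermitianStructure

theorem exists_isSmoothSection_ne_zero [VectorBundle ℂ ℂ E] [IsSmoothLineBundle E] (x : ℂ) :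
    ∃ σ : ∀ y, E y, IsSmoothSection σ ∧ σ x ≠ 0 := by
  obtain ⟨σ, hσ, hb, -⟩ := exists_frame (E := E) x
  obtain ⟨a, ha⟩ := exists_fiber_ne_zero (E := E) x
  refine ⟨σ, hσ, fun h => ha ?_⟩
  obtain ⟨c, hc⟩ := hb a
  rw [hc, h, smul_zero]

/-- A section that is locally a smooth multiple of a smooth section is smooth. -/
theorem exists_isSmoothSection_eventuallyEq_smul [VectorBundle ℂ ℂ E] {σ : ∀ y, E y}
    (hσ : IsSmoothSection σ) {g : ℂ → ℂ} {x : ℂ} (hg : ∀ᶠ y in 𝓝 x, ContDiffAt ℝ ∞ g y) :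
    ∃ t : ∀ y, E y, IsSmoothSection t ∧ ∀ᶠ y in 𝓝 x, t y = g y • σ y := by
  obtain ⟨b, hb, hb1, -, hbU⟩ := exists_cutoff hg
  refine ⟨_, hσ.smul (contDiff_cutoff_mul hb fun y hy => hbU hy), ?_⟩
  filter_upwards [hb1] with y hy
  rw [hy, one_mul]

namespace LineConnection

variable (nab : LineConnection E)

/-- A connection is a local operator satisfying the Leibniz rule for locally defined coefficients. -/
theorem toFun_of_eventuallyEq_smul [VectorBundle ℂ ℂ E] {s σ : ∀ y, E y} (hs : IsSmoothSection s)
    (hσ : IsSmoothSection σ) {g : ℂ → ℂ} {x : ℂ} (hg : ∀ᶠ y in 𝓝 x, ContDiffAt ℝ ∞ g y)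
    (h : ∀ᶠ y in 𝓝 x, s y = g y • σ y) (v : ℂ) :
    nab.toFun s x v = fderiv ℝ g x v • σ x + g x • nab.toFun σ x v := by
  -- The global section b s = (b g)σ is differentiated by the Leibniz rule in both forms; at x, b =
  -- 1 and db = 0.
  obtain ⟨b, hb, hb1, -, hbU⟩ := exists_cutoff (hg.and h)
  have hbg := contDiff_cutoff_mul hb fun y hy => (hbU hy).1
  have heq : (fun y => b y • s y) = fun y => (b y * g y) • σ y := by
    funext y
    by_cases hy : y ∈ tsupport b
    · rw [(hbU hy).2, smul_smul]
    · rw [image_eq_zero_of_notMem_tsupport hy]; simp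
  have h1 := nab.leibniz b s hb hs x v
  have h2 := nab.leibniz _ σ hbg hσ x v
  have hbx : b x = 1 := hb1.self_of_nhds
  have hdb : fderiv ℝ b x = 0 := by
    rw [EventuallyEq.fderiv_eq (show b =ᶠ[𝓝 x] fun _ => 1 from hb1)]; simp
  have hdg : fderiv ℝ (fun y => b y * g y) x = fderiv ℝ g x :=
    EventuallyEq.fderiv_eq (by filter_upwards [hb1] with y hy; rw [hy, one_mul])
  rw [heq, h2, hdg, hdb, hbx] at h1
  simpa using h1.symm

theorem toFun_congr [VectorBundle ℂ ℂ E] {s t : ∀ y, E y} (hs : IsSmoothSection s)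
    (ht : IsSmoothSection t) {x : ℂ} (h : ∀ᶠ y in 𝓝 x, s y = t y) :
    nab.toFun s x = nab.toFun t x := by
  refine LinearMap.ext fun v => ?_
  rw [nab.toFun_of_eventuallyEq_smul hs ht (g := fun _ => 1)
    (Eventually.of_forall fun y => contDiffAt_const) (by simpa using h)]
  simp

theorem dbar_congr [VectorBundle ℂ ℂ E] {s t : ∀ y, E y} (hs : IsSmoothSection s)
    (ht : IsSmoothSection t) {x : ℂ} (h : ∀ᶠ y in 𝓝 x, s y = t y) :
    nab.dbar s x = nab.dbar t x := by
  rw [dbar, dbar, nab.toFun_congr hs ht h]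

theorem dbar_eq_zero_iff (s : ∀ y, E y) (x : ℂ) :
    nab.dbar s x = 0 ↔ nab.toFun s x Complex.I = Complex.I • nab.toFun s x 1 :=
  zeroOnePart_eq_zero_iff _

theorem dbar_eq_zero_of_differentiableAt [VectorBundle ℂ ℂ E] {s σ : ∀ y, E y}
    (hs : IsSmoothSection s) (hσ : IsSmoothSection σ) {g : ℂ → ℂ} {x : ℂ}
    (hg : ∀ᶠ y in 𝓝 x, ContDiffAt ℝ ∞ g y) (h : ∀ᶠ y in 𝓝 x, s y = g y • σ y)
    (hd : nab.dbar σ x = 0) (hgx : DifferentiableAt ℂ g x) : nab.dbar s x = 0 := by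
  rw [dbar_eq_zero_iff] at hd ⊢
  rw [nab.toFun_of_eventuallyEq_smul hs hσ hg h, nab.toFun_of_eventuallyEq_smul hs hσ hg h, hd,
    (differentiableAt_complex_iff_differentiableAt_real.mp hgx).2]
  module

/-- A locally defined multiple of a nonvanishing holomorphic section is holomorphic if and only if
the coefficient satisfies the Cauchy–Riemann equations. -/
theorem dbar_eq_zero_iff_differentiableAt [VectorBundle ℂ ℂ E] {s σ : ∀ y, E y}
    (hs : IsSmoothSection s) (hσ : IsSmoothSection σ) {g : ℂ → ℂ} {x : ℂ}
    (hg : ∀ᶠ y in 𝓝 x, ContDiffAt ℝ ∞ g y) (h : ∀ᶠ y in 𝓝 x, s y = g y • σ y)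
    (hx : σ x ≠ 0) (hd : nab.dbar σ x = 0) : nab.dbar s x = 0 ↔ DifferentiableAt ℂ g x := by
  rw [dbar_eq_zero_iff] at hd ⊢
  rw [nab.toFun_of_eventuallyEq_smul hs hσ hg h, nab.toFun_of_eventuallyEq_smul hs hσ hg h, hd,
    differentiableAt_complex_iff_differentiableAt_real]
  have h1 : DifferentiableAt ℝ g x := hg.self_of_nhds.differentiableAt (by simp)
  have h2 : Complex.I • (fderiv ℝ g x 1 • σ x + g x • nab.toFun σ x 1) =
      (Complex.I • fderiv ℝ g x 1) • σ x + g x • Complex.I • nab.toFun σ x 1 := by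
    module
  rw [h2, add_left_inj]
  constructor
  · exact fun h3 => ⟨h1, smul_left_injective ℂ hx h3⟩
  · exact fun h3 => by rw [h3.2]

/-- Local holomorphic frames exist. -/
theorem exists_local_holomorphic_frame [VectorBundle ℂ ℂ E] [IsSmoothLineBundle E]
    (H : HermitianStructure E) (a : ℂ) :
    ∃ σ : ∀ y, E y, IsSmoothSection σ ∧ ∀ᶠ y in 𝓝 a, σ y ≠ 0 ∧ nab.dbar σ y = 0 := by
  obtain ⟨σ, hσ, hσa⟩ := exists_isSmoothSection_ne_zero (E := E) a
  have hne := H.eventually_ne_zero hσ hσa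
  let θ : ℂ → ℂ → ℂ := fun v => H.coeff σ fun y => nab.toFun σ y v
  -- Here θ v is the connection form of σ in direction v, and A is minus its (0,1)-component. Since
  -- ∂̄(e^w σ) = (∂w/∂z̄ - A) e^w dz̄ ⊗ σ, the section e^w σ is holomorphic wherever ∂w/∂z̄ = A.
  let A : ℂ → ℂ := fun y => -((1 / 2) * (θ 1 y + Complex.I * θ Complex.I y))
  have hA : ∀ᶠ y in 𝓝 a, ContDiffAt ℝ ∞ A y := by
    filter_upwards [hne] with y hy
    have hθ : ∀ v, ContDiffAt ℝ ∞ (θ v) y := fun v =>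
      H.contDiffAt_coeff hσ (nab.smooth σ hσ v) hy
    exact (contDiffAt_const.mul ((hθ 1).add (contDiffAt_const.mul (hθ _)))).neg
  obtain ⟨b, hb, hb1, hbc, hbU⟩ := exists_cutoff hA
  obtain ⟨w, hw, hwA⟩ := exists_wirtingerZbar_eq (contDiff_cutoff_mul hb fun y hy => hbU hy)
    hbc.mul_right
  have hew : ContDiff ℝ ∞ fun y => Complex.exp (w y) := hw.cexp
  refine ⟨_, hσ.smul hew, ?_⟩
  filter_upwards [hne, hb1] with y hy hby
  refine ⟨smul_ne_zero (Complex.exp_ne_zero _) hy, ?_⟩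
  have hd : ∀ v, fderiv ℝ (fun y => Complex.exp (w y)) y v =
      Complex.exp (w y) * fderiv ℝ w y v := fun v => by
    rw [((hw.differentiable (by simp) y).hasFDerivAt.cexp).fderiv]; rfl
  have hw2 := hwA y
  rw [wirtingerZbar, hby, one_mul] at hw2
  rw [dbar_eq_zero_iff, nab.leibniz _ _ hew hσ, nab.leibniz _ _ hew hσ, hd, hd,
    ← H.coeff_smul (fun y => nab.toFun σ y 1) hy,
    ← H.coeff_smul (fun y => nab.toFun σ y Complex.I) hy]
  change _ + _ • θ Complex.I y • _ = _ • (_ + _ • θ 1 y • _)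
  simp only [smul_smul, ← add_smul]
  congr 1
  have hI := Complex.I_sq
  simp only [A] at hw2
  linear_combination (-2 * Complex.I * Complex.exp (w y)) * hw2 +
    Complex.exp (w y) * (fderiv ℝ w y Complex.I + θ Complex.I y) * hI

end LineConnection

end Sections

/-! ### Curvature as a Laplacian, and division of sections by linear factors -/

section Curvature

open Filter Topology InnerProductSpace Laplacian

theorem fderiv_fderiv_comm {h : ℂ → ℝ} {x : ℂ} (hh : ContDiffAt ℝ 2 h x) (v w : ℂ) :
    fderiv ℝ (fun y => fderiv ℝ h y v) x w = fderiv ℝ (fun y => fderiv ℝ h y w) x v := by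
  have hd : DifferentiableAt ℝ (fderiv ℝ h) x :=
    (hh.fderiv_right (m := 1) (by norm_num)).differentiableAt (by norm_num)
  rw [fderiv_clm_apply hd (differentiableAt_const _), fderiv_clm_apply hd (differentiableAt_const _)]
  simpa using hh.isSymmSndFDerivAt (by simp) w v

theorem fderiv_ofReal_comp {a : ℂ → ℝ} {x : ℂ} (ha : DifferentiableAt ℝ a x) (v : ℂ) :
    fderiv ℝ (fun y => (a y : ℂ)) x v = fderiv ℝ a x v := by
  have h := (Complex.ofRealCLM.hasFDerivAt.comp x ha.hasFDerivAt).fderiv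
  rw [show (fun y => (a y : ℂ)) = Complex.ofRealCLM ∘ a from rfl, h]
  rfl

theorem fderiv_ofReal_combination {a b : ℂ → ℝ} {x : ℂ} (ha : DifferentiableAt ℝ a x)
    (hb : DifferentiableAt ℝ b x) (c d v : ℂ) :
    fderiv ℝ (fun y => c * ((a y : ℂ) + d * (b y : ℂ))) x v =
      c * (fderiv ℝ a x v + d * fderiv ℝ b x v) := by
  have ha' : DifferentiableAt ℝ (fun y => (a y : ℂ)) x :=
    Complex.ofRealCLM.differentiableAt.comp x ha
  have hb' : DifferentiableAt ℝ (fun y => (b y : ℂ)) x :=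
    Complex.ofRealCLM.differentiableAt.comp x hb
  have h := ((ha'.hasFDerivAt.add (hb'.hasFDerivAt.const_mul d)).const_mul c).fderiv
  rw [show (fun y => c * ((a y : ℂ) + d * (b y : ℂ))) =
    fun y => c * ((fun y => (a y : ℂ)) + fun y => d * (b y : ℂ)) y from rfl, h]
  simp [fderiv_ofReal_comp ha, fderiv_ofReal_comp hb]
  ring

theorem differentiableAt_fderiv_apply {h : ℂ → ℝ} {x : ℂ} (hh : ContDiffAt ℝ 2 h x) (v : ℂ) :
    DifferentiableAt ℝ (fun y => fderiv ℝ h y v) x :=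
  ((hh.fderiv_right (m := 1) (by norm_num)).differentiableAt (by norm_num)).clm_apply
    (differentiableAt_const v)

/-- The operator ∂²/∂z∂z̄ is Δ/4, the mixed derivatives cancelling by symmetry, and dz ∧ dz̄
contributes the factor -2i. -/
theorem ddbar_eq_laplacian {α : ℂ → ℝ} {x : ℂ} (h : ContDiffAt ℝ 2 α x) :
    ddbar α x = -(Complex.I / 2) * (Δ α x : ℝ) := by
  have h1 : wirtingerZbar (fun y => (α y : ℂ)) =ᶠ[𝓝 x] fun y =>
      (1 / 2 : ℂ) * ((fderiv ℝ α y 1 : ℂ) + Complex.I * (fderiv ℝ α y Complex.I : ℂ)) := by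
    filter_upwards [h.eventually (by simp)] with y hy
    have hd := hy.differentiableAt (by norm_num)
    rw [wirtingerZbar, fderiv_ofReal_comp hd, fderiv_ofReal_comp hd]
  have hd := differentiableAt_fderiv_apply h
  rw [ddbar, wirtingerZ, h1.fderiv_eq, fderiv_ofReal_combination (hd 1) (hd _),
    fderiv_ofReal_combination (hd 1) (hd _), laplacian_eq_fderiv_fderiv h,
    fderiv_fderiv_comm h 1 Complex.I]
  push_cast
  have hI := Complex.I_sq
  generalize fderiv ℝ (fun y => fderiv ℝ α y 1) x 1 = a
  generalize fderiv ℝ (fun y => fderiv ℝ α y Complex.I) x 1 = b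
  generalize fderiv ℝ (fun y => fderiv ℝ α y Complex.I) x Complex.I = d
  linear_combination ((1 / 2 : ℂ) * Complex.I * d) * hI

theorem contDiffAt_real_of_differentiableOn {q : ℂ → ℂ} {U : Set ℂ} (hU : IsOpen U)
    (hq : DifferentiableOn ℂ q U) {y : ℂ} (hy : y ∈ U) : ContDiffAt ℝ ∞ q y :=
  (hq.analyticAt (hU.mem_nhds hy)).contDiffAt.restrict_scalars ℝ

universe u

variable {E : ℂ → Type u} [TopologicalSpace (TotalSpace ℂ E)]
  [∀ x, AddCommGroup (E x)] [∀ x, Module ℂ (E x)] [∀ x, TopologicalSpace (E x)]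
  [FiberBundle ℂ E] [VectorBundle ℂ ℂ E] [IsSmoothLineBundle E]

namespace LineConnection

/-- The curvature of a Hermitian connection in terms of the norm of a holomorphic section. -/
theorem curvature_eq_laplacian_log_sq (nab : LineConnection E) {H : HermitianStructure E}
    (hH : nab.IsHermitian H) {s : ∀ x, E x} (hs : IsSmoothSection s) {x : ℂ} (hx : s x ≠ 0)
    (hol : ∀ᶠ y in 𝓝 x, nab.dbar s y = 0) :
    nab.curvature x = Complex.I / 2 * (Δ (fun y => Real.log (H.sq s y)) x : ℝ) := by
  let θ : ℂ → ℂ := H.coeff s fun y => nab.toFun s y 1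
  let l : ℂ → ℝ := fun y => Real.log (H.sq s y)
  have hne := H.eventually_ne_zero hs hx
  have hθC : ∀ᶠ y in 𝓝 x, ContDiffAt ℝ ∞ θ y := by
    filter_upwards [hne] with y hy using H.contDiffAt_coeff hs (nab.smooth s hs 1) hy
  have h1 : ∀ᶠ y in 𝓝 x, nab.toFun s y 1 = θ y • s y := by
    filter_upwards [hne] with y hy
    exact (H.coeff_smul (fun y => nab.toFun s y 1) hy).symm
  have h2 : ∀ᶠ y in 𝓝 x, nab.toFun s y Complex.I = (Complex.I * θ y) • s y := by
    filter_upwards [h1, hol] with y hy hd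
    rw [(nab.dbar_eq_zero_iff s y).mp hd, hy, smul_smul]
  -- Near x, holomorphy gives ∇s = θ dz ⊗ s. Compatibility with H gives dl = θ dz plus its
  -- conjugate, so that θ = ∂l/∂z, the connection form of the Chern connection.
  have hθl : θ =ᶠ[𝓝 x] fun y =>
      (1 / 2 : ℂ) * ((fderiv ℝ l y 1 : ℂ) + (-Complex.I) * (fderiv ℝ l y Complex.I : ℂ)) := by
    filter_upwards [h1, h2, hne] with y hy1 hyI hy
    have hpos := H.sq_pos hy
    have hdsq : DifferentiableAt ℝ (H.sq s) y := (H.contDiff_sq hs).differentiable (by simp) y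
    have hl : ∀ v c : ℂ, nab.toFun s y v = c • s y → (fderiv ℝ l y v : ℂ) = conj c + c := by
      intro v c hc
      have e1 := hH s s hs hs y v
      rw [hc, map_smulₛₗ, LinearMap.smul_apply, map_smul, H.inner_self,
        show (fun y => H.inner y (s y) (s y)) = fun y => (H.sq s y : ℂ) from
          funext (H.inner_self s), fderiv_ofReal_comp hdsq, smul_eq_mul, smul_eq_mul] at e1
      have e2 : fderiv ℝ l y v = (H.sq s y)⁻¹ * fderiv ℝ (H.sq s) y v := by
        rw [(hdsq.hasFDerivAt.log hpos.ne').fderiv]; rfl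
      have hne' : (H.sq s y : ℂ) ≠ 0 := by exact_mod_cast hpos.ne'
      rw [e2]
      push_cast
      rw [e1]
      field_simp
    rw [hl 1 _ hy1, hl _ _ hyI, map_mul, Complex.conj_I]
    have hI := Complex.I_sq
    linear_combination ((1 / 2 : ℂ) * (θ y - conj (θ y))) * hI
  have hlC : ContDiffAt ℝ 2 l x := (H.contDiffAt_log_sq hs hx).of_le ENat.LEInfty.out
  have hd := differentiableAt_fderiv_apply hlC
  have hdθ : ∀ v, fderiv ℝ θ x v = _ := fun v => by
    rw [hθl.fderiv_eq, fderiv_ofReal_combination (hd 1) (hd _)]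
  have hdIθ : ∀ v, fderiv ℝ (fun y => Complex.I * θ y) x v = Complex.I * fderiv ℝ θ x v := by
    intro v
    rw [((hθC.self_of_nhds.differentiableAt (by simp)).hasFDerivAt.const_mul Complex.I).fderiv]
    rfl
  have hcurv := nab.curvature_spec x s hs
  rw [curvatureOp, nab.toFun_of_eventuallyEq_smul (nab.smooth s hs Complex.I) hs
      (hθC.mono fun y hy => contDiffAt_const.mul hy) h2,
    nab.toFun_of_eventuallyEq_smul (nab.smooth s hs 1) hs hθC h1, h2.self_of_nhds,
    h1.self_of_nhds, hdIθ, hdθ, hdθ, fderiv_fderiv_comm hlC 1 Complex.I] at hcurv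
  -- The terms quadratic in θ cancel, leaving i θ_x - θ_y = 2i ∂θ/∂z̄ = (i/2) Δl.
  have hcurv2 := smul_left_injective ℂ hx (hcurv.symm.trans (show _ = (_ : ℂ) • s x by
    simp only [smul_smul, ← add_smul, ← sub_smul]; rfl))
  rw [hcurv2, laplacian_eq_fderiv_fderiv hlC]
  push_cast
  have hI := Complex.I_sq
  generalize fderiv ℝ (fun y => fderiv ℝ l y 1) x 1 = a
  generalize fderiv ℝ (fun y => fderiv ℝ l y Complex.I) x 1 = b
  generalize fderiv ℝ (fun y => fderiv ℝ l y Complex.I) x Complex.I = d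
  linear_combination (-(1 / 2 : ℂ) * b) * hI

/-- A holomorphic section can be divided by a linear factor at a zero. -/
theorem exists_eq_sub_smul (nab : LineConnection E) (H : HermitianStructure E) {s : ∀ x, E x}
    (hs : IsSmoothSection s) (hol : ∀ x, nab.dbar s x = 0) {a : ℂ} (ha : s a = 0) :
    ∃ t : ∀ x, E x, IsSmoothSection t ∧ (∀ x, nab.dbar t x = 0) ∧ ∀ z, s z = (z - a) • t z := by
  classical
  obtain ⟨σ, hσ, hev⟩ := nab.exists_local_holomorphic_frame H a
  obtain ⟨r, hr, hball⟩ := Metric.eventually_nhds_iff_ball.mp hev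
  let φ : ℂ → ℂ := H.coeff σ s
  have hφ : ∀ y ∈ Metric.ball a r, φ y • σ y = s y := fun y hy => H.coeff_smul s (hball y hy).1
  have hφd : DifferentiableOn ℂ φ (Metric.ball a r) := by
    intro y hy
    have hnear := Metric.isOpen_ball.mem_nhds hy
    refine ((nab.dbar_eq_zero_iff_differentiableAt hs hσ (g := φ) ?_ ?_ (hball y hy).1
      (hball y hy).2).mp (hol y)).differentiableWithinAt
    · filter_upwards [hnear] with z hz using H.contDiffAt_coeff hσ hs (hball z hz).1
    · filter_upwards [hnear] with z hz using (hφ z hz).symm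
  have hφa : φ a = 0 := by
    have := hφ a (Metric.mem_ball_self hr)
    rw [ha] at this
    exact (smul_eq_zero.mp this).resolve_right (hball a (Metric.mem_ball_self hr)).1
  -- The quotient φ/(z - a), with the value φ'(a) filled in at a; it is holomorphic by removability
  -- of the singularity.
  let q : ℂ → ℂ := dslope φ a
  have hqd : DifferentiableOn ℂ q (Metric.ball a r) :=
    (Complex.differentiableOn_dslope (Metric.ball_mem_nhds a hr)).mpr hφd
  -- The two formulas agree on the punctured ball, so t is smooth and holomorphic across the
  -- boundary of the ball.
  let t : ∀ x, E x := fun y => if y ∈ Metric.ball a r then q y • σ y else (y - a)⁻¹ • s y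
  have ht1 : ∀ y ∈ Metric.ball a r, t y = q y • σ y := fun y hy => if_pos hy
  have ht2 : ∀ y, y ≠ a → t y = (y - a)⁻¹ • s y := fun y hy => by
    by_cases hyb : y ∈ Metric.ball a r
    · rw [ht1 y hyb, ← hφ y hyb, smul_smul]
      simp only [q]
      rw [dslope_of_ne _ hy, slope_def_field, hφa, sub_zero, div_eq_inv_mul]
    · exact if_neg hyb
  have hev1 : ∀ᶠ y in 𝓝 a, t y = q y • σ y := by
    filter_upwards [Metric.ball_mem_nhds a hr] with y hy using ht1 y hy
  have hqC : ∀ᶠ y in 𝓝 a, ContDiffAt ℝ ∞ q y := by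
    filter_upwards [Metric.ball_mem_nhds a hr] with y hy using
      contDiffAt_real_of_differentiableOn Metric.isOpen_ball hqd hy
  have hev2 : ∀ x, x ≠ a → ∀ᶠ y in 𝓝 x, t y = (y - a)⁻¹ • s y := fun x hx => by
    filter_upwards [isOpen_ne.mem_nhds hx] with y hy using ht2 y hy
  have hinvC : ∀ x, x ≠ a → ∀ᶠ y in 𝓝 x, ContDiffAt ℝ ∞ (fun y : ℂ => (y - a)⁻¹) y :=
    fun x hx => by
      filter_upwards [isOpen_ne.mem_nhds hx] with y hy
      exact (contDiffAt_id.sub contDiffAt_const).inv (sub_ne_zero.mpr hy)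
  have htS : IsSmoothSection t := by
    refine IsSmoothSection.of_eventuallyEq fun x => ?_
    by_cases hx : x = a
    · subst hx
      obtain ⟨t', ht', h⟩ := exists_isSmoothSection_eventuallyEq_smul hσ hqC
      exact ⟨t', ht', by filter_upwards [h, hev1] with y h1 h2; rw [h1, h2]⟩
    · obtain ⟨t', ht', h⟩ := exists_isSmoothSection_eventuallyEq_smul hs (hinvC x hx)
      exact ⟨t', ht', by filter_upwards [h, hev2 x hx] with y h1 h2; rw [h1, h2]⟩
  refine ⟨t, htS, fun x => ?_, fun z => ?_⟩
  · by_cases hx : x = a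
    · subst hx
      exact nab.dbar_eq_zero_of_differentiableAt htS hσ hqC hev1
        (hball x (Metric.mem_ball_self hr)).2
        (hqd.differentiableAt (Metric.ball_mem_nhds x hr))
    · exact nab.dbar_eq_zero_of_differentiableAt htS hs (hinvC x hx) (hev2 x hx) (hol x)
        ((differentiableAt_id.sub_const a).inv (sub_ne_zero.mpr hx))
  · by_cases hz : z = a
    · subst hz; rw [ha, sub_self, zero_smul]
    · rw [ht2 z hz, smul_smul, mul_inv_cancel₀ (sub_ne_zero.mpr hz), one_smul]

end LineConnection

end Curvature

/-! ### A priori bound and zeros of the Higgs field -/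

section Vortices

open Filter Topology InnerProductSpace Laplacian

universe u

variable {E : ℂ → Type u} [TopologicalSpace (TotalSpace ℂ E)]
  [∀ x, AddCommGroup (E x)] [∀ x, Module ℂ (E x)] [∀ x, TopologicalSpace (E x)]
  [FiberBundle ℂ E] [VectorBundle ℂ ℂ E] [IsSmoothLineBundle E]

namespace IsVortex

variable {D : HolomorphicStructure E} {H : HermitianStructure E} {nab : LineConnection E}
  {Φ : ∀ x, E x}

theorem curvature_eq_density (hv : IsVortex 4 D H nab Φ) (x : ℂ) :
    nab.curvature x = -(Complex.I / 2) * ((esDensity x * (4 - H.sq Φ x) : ℝ) : ℂ) := by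
  have h := hv.curvature_eq x
  have hd : (esDensity x : ℂ) ≠ 0 := by exact_mod_cast (esDensity_pos x).ne'
  rw [H.inner_self, LineConnection.lambdaCurvature] at h
  push_cast at h ⊢
  rw [← h]
  field_simp
  linear_combination nab.curvature x * Complex.I_sq

/-- The section s may be any local holomorphic section, while Φ enters only on the right. This lets
the same equation serve for Φ, for its quotients by linear factors and for local frames. -/
theorem laplacian_log_sq (hv : IsVortex 4 D H nab Φ) {s : ∀ x, E x} (hs : IsSmoothSection s)
    {x : ℂ} (hx : s x ≠ 0) (hol : ∀ᶠ y in 𝓝 x, nab.dbar s y = 0) :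
    Δ (fun y => Real.log (H.sq s y)) x = esDensity x * (H.sq Φ x - 4) := by
  have h := nab.curvature_eq_laplacian_log_sq hv.hermitian hs hx hol
  rw [hv.curvature_eq_density] at h
  have hI : Complex.I / 2 ≠ 0 := by simp
  have h2 : ((Δ (fun y => Real.log (H.sq s y)) x : ℝ) : ℂ) =
      ((esDensity x * (H.sq Φ x - 4) : ℝ) : ℂ) := by
    apply mul_left_cancel₀ hI
    rw [← h]
    push_cast
    ring
  exact_mod_cast h2

/-- The Higgs field of a vortex is bounded. -/
theorem sq_le (hv : IsVortex 4 D H nab Φ) (z₀ : ℂ) : H.sq Φ z₀ ≤ 16 := by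
  by_contra hlt
  push Not at hlt
  set k := Real.sqrt (H.sq Φ z₀) with hk
  have hk2 : k ^ 2 = H.sq Φ z₀ := Real.sq_sqrt (H.sq_nonneg _ _)
  have hk4 : 4 < k := by
    rw [hk, Real.lt_sqrt (by norm_num)]; linarith
  have hρ0 := esRho_nonneg z₀
  -- The second condition says that G(z₀) > 16P² for the function G below. It amounts to (k - 4)P >
  -- kρ(z₀), which holds for large P because k > 4.
  obtain ⟨P, hP1, hPk⟩ : ∃ P : ℝ, 1 ≤ P ∧ 4 * P < k * (P - esRho z₀) := by
    have hk0 : k - 4 ≠ 0 := by linarith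
    refine ⟨k * esRho z₀ / (k - 4) + 1, ?_, ?_⟩
    · have : 0 ≤ k * esRho z₀ / (k - 4) := by
        apply div_nonneg <;> nlinarith
      linarith
    · have : (k - 4) * (k * esRho z₀ / (k - 4) + 1) = k * esRho z₀ + (k - 4) := by
        field_simp
      nlinarith
  have hP0 : 0 ≤ P := by linarith
  have hPρ : esRho z₀ < P := by
    by_contra h
    push Not at h
    nlinarith
  -- The weight vanishes on the circle ρ = P, so the maximum of G over the disc is attained inside.
  let G : ℂ → ℝ := fun y => H.sq Φ y * (P - esRho y) ^ 2
  have hG : Continuous G :=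
    (H.contDiff_sq hv.smooth).continuous.mul ((continuous_const.sub contDiff_esRho.continuous).pow 2)
  have hG0 : 16 * P ^ 2 < G z₀ := by
    have : G z₀ = (k * (P - esRho z₀)) ^ 2 := by simp only [G]; rw [mul_pow, hk2]
    rw [this]
    nlinarith
  have hR2 : Real.sqrt (P * Real.exp P) ^ 2 = P * Real.exp P := Real.sq_sqrt (by positivity)
  obtain ⟨z, hzR, hzG, hmax⟩ := exists_laplacian_log_nonpos (R := Real.sqrt (P * Real.exp P))
    (z₀ := z₀) hG
    (by rw [Real.lt_sqrt (norm_nonneg _)]; exact (esRho_lt_iff hP0 _).mp hPρ)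
    (lt_of_le_of_lt (by positivity) hG0)
    (fun w hw => by
      have : esRho w = P := esRho_eq_of_norm_sq hP0 (by rw [hw, hR2])
      have : G w = 0 := by simp [G, this]
      rw [this]
      exact lt_of_le_of_lt (by positivity) hG0)
  have hzP : esRho z < P := by
    rw [esRho_lt_iff hP0, ← hR2]
    exact pow_lt_pow_left₀ hzR (norm_nonneg _) (by norm_num)
  have hGz : 16 * P ^ 2 < G z := hG0.trans_le hzG
  have hρz := esRho_nonneg z
  have hd : 0 < P - esRho z := by linarith
  have hfz : 0 < H.sq Φ z := by
    refine lt_of_le_of_ne (H.sq_nonneg _ _) fun h => ?_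
    have : G z = 0 := by simp [G, ← h]
    rw [this] at hGz
    nlinarith [sq_nonneg P]
  have hΦz : Φ z ≠ 0 := H.ne_zero_of_sq_pos hfz
  let g : ℝ → ℝ := fun t => 2 * Real.log (P - t)
  have heq : (fun y => Real.log (G y)) =ᶠ[𝓝 z]
      (fun y => Real.log (H.sq Φ y)) + fun y => g (esRho y) := by
    filter_upwards [H.eventually_ne_zero hv.smooth hΦz,
      contDiff_esRho.continuous.continuousAt.eventually (gt_mem_nhds hzP)] with y hy1 hy2
    have : P - esRho y ≠ 0 := by linarith
    simp only [G, g, Pi.add_apply]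
    rw [Real.log_mul (H.sq_pos hy1).ne' (pow_ne_zero 2 this), Real.log_pow]
    norm_num
  have hC1 : ContDiffAt ℝ 2 (fun y => Real.log (H.sq Φ y)) z :=
    (H.contDiffAt_log_sq hv.smooth hΦz).of_le ENat.LEInfty.out
  have hgC : ContDiffAt ℝ 2 g (esRho z) :=
    contDiffAt_const.mul ((contDiffAt_const.sub contDiffAt_id).log (by simpa using hd.ne'))
  have hC2 : ContDiffAt ℝ 2 (fun y => g (esRho y)) z :=
    hgC.comp z (contDiff_esRho.of_le ENat.LEInfty.out).contDiffAt
  have hsub : ∀ t : ℝ, HasDerivAt (fun t => P - t) (-1) t := fun t =>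
    (hasDerivAt_id t).const_sub P
  have hg : ∀ᶠ t in 𝓝 (esRho z), HasDerivAt g (-2 * (P - t)⁻¹) t := by
    filter_upwards [gt_mem_nhds hzP] with t ht
    refine (((hsub t).log (by linarith)).const_mul 2).congr_deriv ?_
    ring
  have hg' : HasDerivAt (fun t => -2 * (P - t)⁻¹) (-2 / (P - esRho z) ^ 2) (esRho z) := by
    refine (((hsub (esRho z)).inv hd.ne').const_mul (-2)).congr_deriv ?_
    ring
  have hΔ := hmax ((hC1.add hC2).congr_of_eventuallyEq heq)
  rw [laplacian_congr_nhds heq |>.self_of_nhds, hC1.laplacian_add hC2,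
    hv.laplacian_log_sq hv.smooth hΦz (Eventually.of_forall hv.holomorphic),
    laplacian_comp_esRho z hgC hg hg', ← mul_add] at hΔ
  have hΔ2 := nonpos_of_mul_nonpos_right hΔ (esDensity_pos z)
  have hmul := mul_le_mul_of_nonneg_left hΔ2 (sq_nonneg (P - esRho z))
  -- At the maximum, Δ log G ≤ 0 thus reads G ≤ 4(P - ρ)² + 4ρ(1 + ρ) + 4(P - ρ). For 0 ≤ ρ ≤ P and
  -- P ≥ 1 the right-hand side is at most 4P² + 4P ≤ 8P², against G > 16P².
  have hexp : (P - esRho z) ^ 2 * (H.sq Φ z - 4 + (2 * esRho z * (1 + esRho z) *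
      (-2 / (P - esRho z) ^ 2) + 2 * (-2 * (P - esRho z)⁻¹))) =
      G z - 4 * (P - esRho z) ^ 2 - 4 * esRho z * (1 + esRho z) - 4 * (P - esRho z) := by
    simp only [G]
    field_simp
    ring
  rw [hexp, mul_zero] at hmul
  nlinarith

/-- A Higgs field divisible by two linear factors vanishes identically. -/
theorem eq_zero_of_eq_mul_smul (hv : IsVortex 4 D H nab Φ) {Ψ : ∀ x, E x}
    (hΨ : IsSmoothSection Ψ) (hol : ∀ x, nab.dbar Ψ x = 0) {a b : ℂ}
    (h : ∀ z, Φ z = ((z - a) * (z - b)) • Ψ z) (z₀ : ℂ) : Φ z₀ = 0 := by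
  by_contra hΦ0
  have hΨ0 : Ψ z₀ ≠ 0 := fun h0 => hΦ0 (by rw [h, h0, smul_zero])
  -- Where Ψ ≠ 0, Δ log F = w|Φ|² ≥ 0, because the contributions -4w of |Ψ|² and +4w of e^{2ρ}
  -- cancel.
  let F : ℂ → ℝ := fun y => H.sq Ψ y * Real.exp (2 * esRho y)
  have hF0 : 0 < F z₀ := mul_pos (H.sq_pos hΨ0) (Real.exp_pos _)
  have hFC : Continuous F := (H.contDiff_sq hΨ).continuous.mul
    (Real.continuous_exp.comp (continuous_const.mul contDiff_esRho.continuous))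
  -- Far out, |z - a| and |z - b| are at least |z|/2. Hence 16 ≥ |Φ|² ≥ |z|⁴|Ψ|²/16, that is, Fρ² ≤
  -- 256. Then ρ ≥ 1 and ρ ≥ 512/F(z₀) give F ≤ F(z₀)/2.
  have hfar : ∀ᶠ z in cocompact ℂ, F z ≤ F z₀ / 2 := by
    have hn : ∀ c : ℝ, ∀ᶠ z : ℂ in cocompact ℂ, c ≤ ‖z‖ := fun c =>
      tendsto_norm_cocompact_atTop.eventually (eventually_ge_atTop c)
    filter_upwards [hn (2 * ‖a‖), hn (2 * ‖b‖), hn 1,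
      tendsto_esRho.eventually (eventually_ge_atTop (max 1 (512 / F z₀)))] with z ha hb h1 hρ
    have hsub : ∀ c : ℂ, 2 * ‖c‖ ≤ ‖z‖ → ‖z‖ ^ 2 / 4 ≤ ‖z - c‖ ^ 2 := fun c hc => by
      have := norm_sub_norm_le z c
      have h0 := norm_nonneg z
      nlinarith
    have hq : ‖z‖ ^ 4 / 16 ≤ ‖(z - a) * (z - b)‖ ^ 2 := by
      have := mul_le_mul (hsub a ha) (hsub b hb) (by positivity) (by positivity)
      rw [norm_mul, mul_pow]
      linarith
    have hexp := Real.exp_pos (esRho z)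
    have h4 : ‖z‖ ^ 4 = esRho z ^ 2 * Real.exp (2 * esRho z) := by
      have : ‖z‖ ^ 4 = (‖z‖ ^ 2) ^ 2 := by ring
      rw [this, ← esRho_mul_exp, two_mul, Real.exp_add]
      ring
    have hsq := H.sq_of_eq_smul (h z)
    have h16 := hv.sq_le z
    have hΨz := H.sq_nonneg Ψ z
    have hE := Real.exp_pos (2 * esRho z)
    have hmain : H.sq Ψ z * (esRho z ^ 2 * Real.exp (2 * esRho z)) ≤ 256 := by
      rw [← h4]
      nlinarith [mul_le_mul_of_nonneg_right hq hΨz]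
    have hρ1 : 1 ≤ esRho z := (le_max_left _ _).trans hρ
    have hρ2 : 512 ≤ esRho z * F z₀ := by
      rw [← div_le_iff₀ hF0]; exact (le_max_right _ _).trans hρ
    have hFz : 0 ≤ F z := mul_nonneg hΨz hE.le
    have hFm : F z * esRho z ^ 2 ≤ 256 := by
      have : F z * esRho z ^ 2 = H.sq Ψ z * (esRho z ^ 2 * Real.exp (2 * esRho z)) := by
        simp only [F]; ring
      rw [this]; exact hmain
    have hFm2 : F z * esRho z ≤ 256 := by nlinarith [mul_nonneg hFz (by linarith : 0 ≤ esRho z)]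
    by_contra hcon
    push Not at hcon
    nlinarith
  obtain ⟨R₀, hR₀⟩ : ∃ R₀ : ℝ, ∀ z : ℂ, R₀ ≤ ‖z‖ → F z ≤ F z₀ / 2 := by
    rw [← Metric.cobounded_eq_cocompact, ← comap_norm_atTop] at hfar
    obtain ⟨S, hS, hSF⟩ := hfar
    obtain ⟨R₀, hR₀⟩ := mem_atTop_sets.mp hS
    exact ⟨R₀, fun z hz => hSF (hR₀ _ hz)⟩
  set R := max R₀ (‖z₀‖ + 1) with hR
  have hlog2 : 0 < Real.log 2 := Real.log_pos (by norm_num)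
  -- The factor e^{c|z|²} makes the subharmonicity strict, adding 4c to the Laplacian of the
  -- logarithm. The choice of c keeps it below 2 on the disc, so it does not use up the factor 1/2
  -- gained on the boundary.
  let c : ℝ := Real.log 2 / (R ^ 2 + 1)
  have hc : 0 < c := by positivity
  have hcR : Real.exp (c * R ^ 2) < 2 := by
    rw [← Real.lt_log_iff_exp_lt (by norm_num)]
    have : c * (R ^ 2 + 1) = Real.log 2 := by simp only [c]; field_simp
    nlinarith
  let G : ℂ → ℝ := fun y => F y * Real.exp (c * ‖y‖ ^ 2)
  have hGC : Continuous G := hFC.mul (by fun_prop)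
  have hG0 : F z₀ ≤ G z₀ := le_mul_of_one_le_right hF0.le (Real.one_le_exp (by positivity))
  obtain ⟨z, hzR, hzG, hmax⟩ := exists_laplacian_log_nonpos (R := R) (z₀ := z₀) hGC
    ((lt_add_one _).trans_le (le_max_right _ _)) (hF0.trans_le hG0) (fun w hw => by
      have h1 := hR₀ w (by rw [hw]; exact le_max_left _ _)
      refine lt_of_lt_of_le ?_ hG0
      simp only [G]
      rw [hw]
      have := Real.exp_pos (c * R ^ 2)
      nlinarith)
  have hΨz : Ψ z ≠ 0 := by
    intro h0
    have : G z = 0 := by simp [G, F, H.sq_eq_zero h0]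
    linarith
  have heq : (fun y => Real.log (G y)) =ᶠ[𝓝 z]
      ((fun y => Real.log (H.sq Ψ y)) + fun y => 2 * esRho y) + fun y => c * ‖y‖ ^ 2 := by
    filter_upwards [H.eventually_ne_zero hΨ hΨz] with y hy
    have h1 := (H.sq_pos hy).ne'
    simp only [G, F, Pi.add_apply]
    rw [Real.log_mul (mul_ne_zero h1 (Real.exp_ne_zero _)) (Real.exp_ne_zero _),
      Real.log_mul h1 (Real.exp_ne_zero _), Real.log_exp, Real.log_exp]
  have hC1 : ContDiffAt ℝ 2 (fun y => Real.log (H.sq Ψ y)) z :=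
    (H.contDiffAt_log_sq hΨ hΨz).of_le ENat.LEInfty.out
  have hC2 : ContDiffAt ℝ 2 (fun y => 2 * esRho y) z :=
    (contDiff_const.mul (contDiff_esRho.of_le ENat.LEInfty.out)).contDiffAt
  have hC3 : ContDiffAt ℝ 2 (fun y : ℂ => c * ‖y‖ ^ 2) z :=
    (contDiff_const.mul (contDiff_norm_sq ℝ)).contDiffAt
  have hC12 : ContDiffAt ℝ 2 ((fun y => Real.log (H.sq Ψ y)) + fun y => 2 * esRho y) z :=
    hC1.add hC2
  have hΔ := hmax ((hC12.add hC3).congr_of_eventuallyEq heq)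
  rw [laplacian_congr_nhds heq |>.self_of_nhds, hC12.laplacian_add hC3,
    hC1.laplacian_add hC2, hv.laplacian_log_sq hΨ hΨz (Eventually.of_forall hol),
    laplacian_norm_sq, laplacian_comp_esRho (g := fun t => 2 * t) (g' := fun _ => 2) (c := 0) z
      (contDiffAt_const.mul contDiffAt_id)
      (Eventually.of_forall fun t => by simpa using (hasDerivAt_id t).const_mul 2)
      (hasDerivAt_const _ _)] at hΔ
  have h1 := mul_nonneg (esDensity_pos z).le (H.sq_nonneg Φ z)
  nlinarith

/-- The Higgs field of a vortex is identically zero, or nowhere zero, or has a single simple zero. -/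
theorem eq_zero_or_exists_frame (hv : IsVortex 4 D H nab Φ) :
    (∀ x, Φ x = 0) ∨ ∃ (s : ∀ x, E x) (p : Polynomial ℂ), IsSmoothSection s ∧
      (∀ x, nab.dbar s x = 0) ∧ (∀ x, s x ≠ 0) ∧ p.natDegree ≤ 1 ∧
      ∀ x, Φ x = p.eval x • s x := by
  by_cases h0 : ∀ x, Φ x ≠ 0
  · exact Or.inr ⟨Φ, 1, hv.smooth, hv.holomorphic, h0, by simp, fun x => by simp⟩
  push Not at h0
  obtain ⟨a, ha⟩ := h0
  obtain ⟨Ψ, hΨ, hol, hΨΦ⟩ := nab.exists_eq_sub_smul H hv.smooth hv.holomorphic ha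
  by_cases h1 : ∀ x, Ψ x ≠ 0
  · exact Or.inr ⟨Ψ, Polynomial.X - Polynomial.C a, hΨ, hol, h1, by simp, fun x => by simp [hΨΦ]⟩
  push Not at h1
  obtain ⟨b, hb⟩ := h1
  obtain ⟨Ξ, hΞ, hol', hΞΨ⟩ := nab.exists_eq_sub_smul H hΨ hol hb
  exact Or.inl (hv.eq_zero_of_eq_mul_smul hΞ hol' (a := a) (b := b) fun z => by
    rw [hΨΦ, hΞΨ, smul_smul])

end IsVortex

end Vortices

/-! ### Gluing holomorphic frames of prescribed norm -/

section FramesOfPrescribedNorm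

open Filter Topology InnerProductSpace Laplacian

universe u

variable {E : ℂ → Type u} [TopologicalSpace (TotalSpace ℂ E)]
  [∀ x, AddCommGroup (E x)] [∀ x, Module ℂ (E x)] [∀ x, TopologicalSpace (E x)]
  [FiberBundle ℂ E]

namespace LineConnection

/-- `s` is, near every point of `S`, a smooth holomorphic section whose squared norm is `W`. -/
def IsFrameOn (nab : LineConnection E) (H : HermitianStructure E) (W : ℂ → ℝ) (s : ∀ x, E x)
    (S : Set ℂ) : Prop :=
  ∀ x ∈ S, ∃ t : ∀ y, E y, IsSmoothSection t ∧
    ∀ᶠ y in 𝓝 x, s y = t y ∧ nab.dbar t y = 0 ∧ H.sq t y = W y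

variable {nab : LineConnection E} {H : HermitianStructure E} {W : ℂ → ℝ}

theorem IsFrameOn.mono {s : ∀ x, E x} {S T : Set ℂ} (h : nab.IsFrameOn H W s T) (hST : S ⊆ T) :
    nab.IsFrameOn H W s S := fun x hx => h x (hST hx)

theorem IsFrameOn.congr {s s' : ∀ x, E x} {S U : Set ℂ} (h : nab.IsFrameOn H W s S)
    (hU : IsOpen U) (hss : ∀ y ∈ U, s' y = s y) : nab.IsFrameOn H W s' (S ∩ U) := by
  rintro x ⟨hx, hxU⟩
  obtain ⟨t, ht, hev⟩ := h x hx
  refine ⟨t, ht, ?_⟩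
  filter_upwards [hev, hU.mem_nhds hxU] with y hy hyU
  exact ⟨(hss y hyU).trans hy.1, hy.2⟩

theorem IsFrameOn.union {s : ∀ x, E x} {S T : Set ℂ} (h : nab.IsFrameOn H W s S)
    (h' : nab.IsFrameOn H W s T) : nab.IsFrameOn H W s (S ∪ T) :=
  fun x hx => hx.elim (h x) (h' x)

theorem IsFrameOn.sq_eq {s : ∀ x, E x} {S : Set ℂ} (h : nab.IsFrameOn H W s S) {x : ℂ}
    (hx : x ∈ S) : H.sq s x = W x := by
  obtain ⟨t, -, hev⟩ := h x hx
  obtain ⟨h1, -, h3⟩ := hev.self_of_nhds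
  rw [← h3, HermitianStructure.sq, h1, HermitianStructure.sq]

variable [VectorBundle ℂ ℂ E]

theorem IsFrameOn.const_smul {s : ∀ x, E x} {S : Set ℂ} (h : nab.IsFrameOn H W s S) {c : ℂ}
    (hc : ‖c‖ = 1) : nab.IsFrameOn H W (fun y => c • s y) S := by
  intro x hx
  obtain ⟨t, ht, hev⟩ := h x hx
  have hct : IsSmoothSection fun y => c • t y := ht.smul (f := fun _ => c) contDiff_const
  refine ⟨_, hct, ?_⟩
  filter_upwards [hev] with y hy
  refine ⟨by rw [hy.1], ?_, ?_⟩
  · exact nab.dbar_eq_zero_of_differentiableAt hct ht (g := fun _ => c)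
      (Eventually.of_forall fun _ => contDiffAt_const) (Eventually.of_forall fun _ => rfl) hy.2.1
      (differentiableAt_const c)
  · rw [H.sq_of_eq_smul (t := t) (c := c) rfl, hc, hy.2.2]; ring

/-- Two such frames on a connected open set differ by a constant phase. -/
theorem IsFrameOn.exists_eq_const_smul (hW : ∀ x, 0 < W x) {s₁ s₂ : ∀ x, E x} {S : Set ℂ}
    (hS : IsOpen S) (hSc : IsPreconnected S) (h₁ : nab.IsFrameOn H W s₁ S)
    (h₂ : nab.IsFrameOn H W s₂ S) : ∃ c : ℂ, ‖c‖ = 1 ∧ ∀ x ∈ S, s₂ x = c • s₁ x := by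
  rcases S.eq_empty_or_nonempty with rfl | ⟨x₀, hx₀⟩
  · exact ⟨1, by simp, by simp⟩
  have hne : ∀ x ∈ S, s₁ x ≠ 0 := fun x hx =>
    H.ne_zero_of_sq_pos (by rw [h₁.sq_eq hx]; exact hW x)
  have hg : ∀ x ∈ S, s₂ x = H.coeff s₁ s₂ x • s₁ x := fun x hx =>
    (H.coeff_smul s₂ (hne x hx)).symm
  have hnorm : ∀ x ∈ S, ‖H.coeff s₁ s₂ x‖ = 1 := fun x hx => by
    have h := H.sq_of_eq_smul (hg x hx)
    rw [h₁.sq_eq hx, h₂.sq_eq hx] at h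
    have h2 : ‖H.coeff s₁ s₂ x‖ ^ 2 = 1 := by
      have := (hW x).ne'
      apply mul_right_cancel₀ this
      linarith
    nlinarith [norm_nonneg (H.coeff s₁ s₂ x)]
  have hd : DifferentiableOn ℂ (H.coeff s₁ s₂) S := by
    intro x hx
    obtain ⟨t₁, ht₁, hev₁⟩ := h₁ x hx
    obtain ⟨t₂, ht₂, hev₂⟩ := h₂ x hx
    have ht₁0 : ∀ᶠ y in 𝓝 x, t₁ y ≠ 0 := by
      filter_upwards [hev₁] with y hy
      exact H.ne_zero_of_sq_pos (by rw [hy.2.2]; exact hW y)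
    have heq : H.coeff s₁ s₂ =ᶠ[𝓝 x] H.coeff t₁ t₂ := by
      filter_upwards [hev₁, hev₂] with y hy₁ hy₂
      rw [HermitianStructure.coeff, hy₁.1, hy₂.1, HermitianStructure.coeff]
    refine (((nab.dbar_eq_zero_iff_differentiableAt ht₂ ht₁ ?_ ?_ ht₁0.self_of_nhds
      hev₁.self_of_nhds.2.1).mp hev₂.self_of_nhds.2.1).congr_of_eventuallyEq
      heq).differentiableWithinAt
    · filter_upwards [ht₁0] with y hy using H.contDiffAt_coeff ht₁ ht₂ hy
    · filter_upwards [ht₁0] with y hy using (H.coeff_smul t₂ hy).symm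
  -- The ratio of the frames is holomorphic of modulus 1, so every point is a maximum of its modulus
  -- and it is constant.
  have hconst := Complex.eqOn_of_isPreconnected_of_isMaxOn_norm hSc hS hd hx₀ (fun y hy => by
    simp only [Set.mem_ofPred_eq, Function.comp]
    rw [hnorm y hy, hnorm x₀ hx₀])
  refine ⟨H.coeff s₁ s₂ x₀, hnorm x₀ hx₀, fun x hx => ?_⟩
  conv_lhs => rw [hg x hx]
  rw [show H.coeff s₁ s₂ x = H.coeff s₁ s₂ x₀ from hconst hx]

/-- The overlap of the two pieces is convex, hence connected, so the frames differ there by one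
phase; dividing the second by this phase makes them match. -/
theorem exists_isFrameOn_of_cover (hW : ∀ x, 0 < W x) {S : Set ℂ} (hS : IsOpen S)
    (hSc : Convex ℝ S) (l : ℂ →L[ℝ] ℝ) {a b : ℝ} (hab : a < b)
    (h₁ : ∃ s, nab.IsFrameOn H W s (S ∩ {x | l x < b}))
    (h₂ : ∃ s, nab.IsFrameOn H W s (S ∩ {x | a < l x})) : ∃ s, nab.IsFrameOn H W s S := by
  classical
  obtain ⟨s₁, h₁⟩ := h₁
  obtain ⟨s₂, h₂⟩ := h₂
  have ho₁ : IsOpen {x | l x < b} := isOpen_lt l.continuous continuous_const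
  have ho₂ : IsOpen {x | a < l x} := isOpen_lt continuous_const l.continuous
  have hconv : Convex ℝ ((S ∩ {x | l x < b}) ∩ {x | a < l x}) :=
    (hSc.inter (convex_halfSpace_lt l.toLinearMap.isLinear b)).inter
      (convex_halfSpace_gt l.toLinearMap.isLinear a)
  obtain ⟨c, hc, hcs⟩ := IsFrameOn.exists_eq_const_smul hW ((hS.inter ho₁).inter ho₂)
    hconv.isPreconnected (h₁.mono Set.inter_subset_left)
    (h₂.mono fun x hx => ⟨hx.1.1, hx.2⟩)
  have hc0 : c ≠ 0 := fun h => by simp [h] at hc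
  let s : ∀ x, E x := fun x => if l x < b ∧ x ∈ S then s₁ x else c⁻¹ • s₂ x
  have e₁ : nab.IsFrameOn H W s ((S ∩ {x | l x < b}) ∩ (S ∩ {x | l x < b})) :=
    h₁.congr (hS.inter ho₁) fun y hy => if_pos ⟨hy.2, hy.1⟩
  have e₂ : nab.IsFrameOn H W s ((S ∩ {x | a < l x}) ∩ {x | a < l x}) := by
    refine (h₂.const_smul (c := c⁻¹) (by rw [norm_inv, hc, inv_one])).congr ho₂ fun y hy => ?_
    by_cases hyb : l y < b ∧ y ∈ S
    · simp only [s, if_pos hyb]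
      rw [hcs y ⟨⟨hyb.2, hyb.1⟩, hy⟩, smul_smul, inv_mul_cancel₀ hc0, one_smul]
    · exact if_neg hyb
  refine ⟨s, (e₁.union e₂).mono fun x hx => ?_⟩
  by_cases hxb : l x < b
  · exact Or.inl ⟨⟨hx, hxb⟩, hx, hxb⟩
  · have : a < l x := hab.trans_le (not_lt.mp hxb)
    exact Or.inr ⟨⟨hx, this⟩, this⟩

/-- The frame is extended from l < -C + kδ/2 to l < -C + (k + 1)δ/2 by a strip of width δ that
overlaps the old region in width δ/2. The induction starts from the empty set, since |l| < C on S.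
-/
theorem exists_isFrameOn_of_strips (hW : ∀ x, 0 < W x) {S : Set ℂ} (hS : IsOpen S)
    (hSc : Convex ℝ S) (hSb : Bornology.IsBounded S) (l : ℂ →L[ℝ] ℝ) {δ : ℝ} (hδ : 0 < δ)
    (h : ∀ m : ℝ, ∃ s, nab.IsFrameOn H W s (S ∩ {x | m < l x ∧ l x < m + δ})) :
    ∃ s, nab.IsFrameOn H W s S := by
  obtain ⟨C, hC⟩ : ∃ C : ℝ, ∀ x ∈ S, |l x| < C := by
    obtain ⟨R, hR⟩ := hSb.exists_norm_le
    refine ⟨‖l‖ * R + 1, fun x hx => ?_⟩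
    have h1 := l.le_opNorm x
    rw [Real.norm_eq_abs] at h1
    nlinarith [mul_le_mul_of_nonneg_left (hR x hx) (norm_nonneg l)]
  have key : ∀ k : ℕ, ∃ s, nab.IsFrameOn H W s (S ∩ {x | l x < -C + k * (δ / 2)}) := by
    intro k
    induction k with
    | zero =>
      refine ⟨0, ?_⟩
      rintro x ⟨hx, hx'⟩
      have := (abs_lt.mp (hC x hx)).1
      simp only [Set.mem_ofPred_eq] at hx'
      push_cast at hx'
      linarith
    | succ k ih =>
      obtain ⟨s₁, h₁⟩ := ih
      obtain ⟨s₂, h₂⟩ := h (-C + k * (δ / 2) - δ / 2)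
      refine exists_isFrameOn_of_cover hW
        (hS.inter (isOpen_lt l.continuous continuous_const))
        (hSc.inter (convex_halfSpace_lt l.toLinearMap.isLinear _)) l
        (a := -C + k * (δ / 2) - δ / 2) (b := -C + k * (δ / 2)) (by linarith)
        ⟨s₁, h₁.mono fun x hx => ⟨hx.1.1, hx.2⟩⟩ ⟨s₂, h₂.mono fun x hx => ⟨hx.1.1, hx.2, ?_⟩⟩
      have := hx.1.2
      simp only [Set.mem_ofPred_eq] at this
      push_cast at this
      linarith
  obtain ⟨k, hk⟩ := exists_nat_gt (2 * C / (δ / 2))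
  obtain ⟨s, hs⟩ := key k
  refine ⟨s, hs.mono fun x hx => ⟨hx, ?_⟩⟩
  have h1 := (abs_lt.mp (hC x hx)).2
  rw [div_lt_iff₀ (by positivity)] at hk
  simp only [Set.mem_ofPred_eq]
  linarith

/-- Strips in the real part and then in the imaginary part reduce the claim to squares of side δ/2.
Each lies in a ball carrying a local frame, because δ is a Lebesgue number of the cover. -/
theorem exists_isFrameOn_ball (hW : ∀ x, 0 < W x)
    (hloc : ∀ a : ℂ, ∃ s, ∃ r > 0, nab.IsFrameOn H W s (Metric.ball a r)) (R : ℝ) :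
    ∃ s, nab.IsFrameOn H W s (Metric.ball 0 R) := by
  choose σ r hr hσ using hloc
  obtain ⟨δ, hδ, hδr⟩ := lebesgue_number_lemma_of_metric (isCompact_closedBall (0 : ℂ) R)
    (c := fun a => Metric.ball a (r a)) (fun a => Metric.isOpen_ball)
    fun x _ => Set.mem_iUnion.mpr ⟨x, Metric.mem_ball_self (hr x)⟩
  have hball := convex_ball (0 : ℂ) R
  refine exists_isFrameOn_of_strips hW Metric.isOpen_ball hball Metric.isBounded_ball Complex.reCLM
    (half_pos hδ) fun m => ?_
  have hso : IsOpen {x : ℂ | m < Complex.reCLM x ∧ Complex.reCLM x < m + δ / 2} :=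
    (isOpen_lt continuous_const Complex.reCLM.continuous).inter
      (isOpen_lt Complex.reCLM.continuous continuous_const)
  have hsc : Convex ℝ {x : ℂ | m < Complex.reCLM x ∧ Complex.reCLM x < m + δ / 2} :=
    (convex_halfSpace_gt Complex.reCLM.toLinearMap.isLinear m).inter
      (convex_halfSpace_lt Complex.reCLM.toLinearMap.isLinear (m + δ / 2))
  refine exists_isFrameOn_of_strips hW (Metric.isOpen_ball.inter hso) (hball.inter hsc)
    (Metric.isBounded_ball.subset Set.inter_subset_left) Complex.imCLM (half_pos hδ) fun m' => ?_
  rcases Set.eq_empty_or_nonempty (Metric.ball (0 : ℂ) R ∩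
    {x | m < Complex.reCLM x ∧ Complex.reCLM x < m + δ / 2} ∩
    {x | m' < Complex.imCLM x ∧ Complex.imCLM x < m' + δ / 2}) with hempty | ⟨x, hx⟩
  · rw [hempty]
    exact ⟨0, fun x hx => hx.elim⟩
  · obtain ⟨a, ha⟩ := hδr x (Metric.ball_subset_closedBall hx.1.1)
    refine ⟨σ a, (hσ a).mono fun y hy => ha ?_⟩
    obtain ⟨⟨-, hx1, hx2⟩, hx3, hx4⟩ := hx
    obtain ⟨⟨-, hy1, hy2⟩, hy3, hy4⟩ := hy
    simp only [Complex.reCLM_apply, Complex.imCLM_apply] at hx1 hx2 hx3 hx4 hy1 hy2 hy3 hy4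
    rw [Metric.mem_ball, dist_eq_norm]
    have hre : |(y - x).re| < δ / 2 := by
      rw [Complex.sub_re, abs_lt]; constructor <;> linarith
    have him : |(y - x).im| < δ / 2 := by
      rw [Complex.sub_im, abs_lt]; constructor <;> linarith
    linarith [Complex.norm_le_abs_re_add_abs_im (y - x)]

/-- Local frames with prescribed norm can be glued to a global one. -/
theorem exists_isFrameOn_univ (hW : ∀ x, 0 < W x)
    (hloc : ∀ a : ℂ, ∃ s, ∃ r > 0, nab.IsFrameOn H W s (Metric.ball a r)) :
    ∃ s, nab.IsFrameOn H W s Set.univ := by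
  have hball := exists_isFrameOn_ball hW hloc
  obtain ⟨s₀, hs₀⟩ := hball 1
  have h0mem : ∀ n : ℕ, (0 : ℂ) ∈ Metric.ball (0 : ℂ) (n + 1) := fun n =>
    Metric.mem_ball_self (by positivity)
  have hs₀0 : s₀ 0 ≠ 0 := H.ne_zero_of_sq_pos (by
    rw [hs₀.sq_eq (Metric.mem_ball_self one_pos)]; exact hW 0)
  -- Fixing the value at 0 removes the phase ambiguity, so the frames on different balls agree where
  -- both are defined.
  have hn : ∀ n : ℕ, ∃ s, nab.IsFrameOn H W s (Metric.ball 0 (n + 1)) ∧ s 0 = s₀ 0 := by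
    intro n
    obtain ⟨s, hs⟩ := hball (n + 1)
    obtain ⟨c, hc, hcs⟩ := IsFrameOn.exists_eq_const_smul hW Metric.isOpen_ball
      (convex_ball (0 : ℂ) 1).isPreconnected
      (hs.mono (Metric.ball_subset_ball (by linarith [n.cast_nonneg (α := ℝ)]))) hs₀
    exact ⟨_, hs.const_smul hc, (hcs 0 (Metric.mem_ball_self one_pos)).symm⟩
  choose s hs hs0 using hn
  have hle : ∀ n m : ℕ, n ≤ m → ∀ y ∈ Metric.ball (0 : ℂ) (n + 1), s m y = s n y := by
    intro n m hnm
    have hnm' : (n : ℝ) ≤ m := by exact_mod_cast hnm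
    obtain ⟨c, hc, hcs⟩ := IsFrameOn.exists_eq_const_smul hW Metric.isOpen_ball
      (convex_ball (0 : ℂ) (n + 1)).isPreconnected (hs n)
      ((hs m).mono (Metric.ball_subset_ball (by linarith)))
    have h0 := hcs 0 (h0mem n)
    rw [hs0, hs0] at h0
    have hc1 : c = 1 := smul_left_injective ℂ hs₀0 (by simpa using h0.symm)
    intro y hy
    rw [hcs y hy, hc1, one_smul]
  have hagree : ∀ n m : ℕ, ∀ y ∈ Metric.ball (0 : ℂ) (n + 1), y ∈ Metric.ball (0 : ℂ) (m + 1) →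
      s m y = s n y := by
    intro n m y hyn hym
    rcases le_total n m with h | h
    · exact hle n m h y hyn
    · exact (hle m n h y hym).symm
  have hN : ∀ y : ℂ, y ∈ Metric.ball (0 : ℂ) (⌈‖y‖⌉₊ + 1) := fun y => by
    rw [mem_ball_zero_iff]
    linarith [Nat.le_ceil ‖y‖]
  -- The index jumps with |y|, but by the agreement near x the section coincides with the single
  -- frame of index ⌈|x|⌉.
  refine ⟨fun y => s ⌈‖y‖⌉₊ y, fun x _ => ?_⟩
  exact (hs ⌈‖x‖⌉₊).congr Metric.isOpen_ball
    (fun y hy => hagree _ ⌈‖y‖⌉₊ y hy (hN y)) x ⟨hN x, hN x⟩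

end LineConnection

/-- A vortex with vanishing Higgs field has a global holomorphic frame. -/
theorem IsVortex.exists_frame_of_eq_zero [VectorBundle ℂ ℂ E] [IsSmoothLineBundle E]
    {D : HolomorphicStructure E} {H : HermitianStructure E} {nab : LineConnection E}
    {Φ : ∀ x, E x} (hv : IsVortex 4 D H nab Φ) (hΦ : ∀ x, Φ x = 0) :
    ∃ s : ∀ x, E x, IsSmoothSection s ∧ (∀ x, nab.dbar s x = 0) ∧ ∀ x, s x ≠ 0 := by
  -- With Φ = 0, a holomorphic frame satisfies Δ log|s|² = -4w, and -2ρ solves the same equation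
  -- globally; e^{-2ρ} is therefore an admissible norm.
  let W : ℂ → ℝ := fun x => Real.exp (-(2 * esRho x))
  have hW : ∀ x, 0 < W x := fun x => Real.exp_pos _
  have hloc : ∀ a : ℂ, ∃ s, ∃ r > 0, nab.IsFrameOn H W s (Metric.ball a r) := by
    intro a
    obtain ⟨σ, hσ, hev⟩ := nab.exists_local_holomorphic_frame H a
    obtain ⟨r, hr, hball⟩ := Metric.eventually_nhds_iff_ball.mp hev
    let h : ℂ → ℝ := (fun y => Real.log (H.sq σ y)) + fun y => 2 * esRho y
    have hC1 : ∀ y ∈ Metric.ball a r, ContDiffAt ℝ 2 (fun y => Real.log (H.sq σ y)) y :=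
      fun y hy => (H.contDiffAt_log_sq hσ (hball y hy).1).of_le ENat.LEInfty.out
    have hC2 : ∀ y, ContDiffAt ℝ 2 (fun y => 2 * esRho y) y := fun y =>
      (contDiff_const.mul (contDiff_esRho.of_le ENat.LEInfty.out)).contDiffAt
    have hharm : HarmonicOnNhd h (Metric.ball a r) := by
      intro x hx
      refine ⟨(hC1 x hx).add (hC2 x), ?_⟩
      filter_upwards [Metric.isOpen_ball.mem_nhds hx] with y hy
      have hhol : ∀ᶠ z in 𝓝 y, nab.dbar σ z = 0 := by
        filter_upwards [Metric.isOpen_ball.mem_nhds hy] with z hz using (hball z hz).2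
      simp only [h]
      rw [(hC1 y hy).laplacian_add (hC2 y), hv.laplacian_log_sq hσ (hball y hy).1 hhol,
        laplacian_comp_esRho (g := fun t => 2 * t) (g' := fun _ => 2) (c := 0) y
          (contDiffAt_const.mul contDiffAt_id)
          (Eventually.of_forall fun t => by simpa using (hasDerivAt_id t).const_mul 2)
          (hasDerivAt_const _ _), H.sq_eq_zero (hΦ y)]
      simp only [Pi.zero_apply]
      ring
    obtain ⟨G, hG, hGh⟩ := hharm.exists_analyticOnNhd_ball_re_eq
    -- Since Re G = log|σ|² + 2ρ, one has |g|² = e^{-Re G} = e^{-2ρ}/|σ|².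
    let g : ℂ → ℂ := fun y => Complex.exp (-G y / 2)
    have hgd : DifferentiableOn ℂ g (Metric.ball a r) := fun y hy =>
      (((hG y hy).differentiableAt.neg.div_const 2).cexp).differentiableWithinAt
    refine ⟨fun y => g y • σ y, r, hr, fun x hx => ?_⟩
    have hxb := Metric.isOpen_ball.mem_nhds hx
    obtain ⟨t, ht, hts⟩ := exists_isSmoothSection_eventuallyEq_smul hσ (g := g) (x := x) (by
      filter_upwards [hxb] with y hy
      exact contDiffAt_real_of_differentiableOn Metric.isOpen_ball hgd hy)
    refine ⟨t, ht, ?_⟩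
    filter_upwards [hts.eventually_nhds, hxb] with y hy hyb
    refine ⟨hy.self_of_nhds.symm, ?_, ?_⟩
    · refine nab.dbar_eq_zero_of_differentiableAt ht hσ (g := g) ?_ hy (hball y hyb).2
        (hgd.differentiableAt (Metric.isOpen_ball.mem_nhds hyb))
      filter_upwards [Metric.isOpen_ball.mem_nhds hyb] with z hz
      exact contDiffAt_real_of_differentiableOn Metric.isOpen_ball hgd hz
    · have hpos := H.sq_pos (hball y hyb).1
      have hre : (G y).re = Real.log (H.sq σ y) + 2 * esRho y := hGh hyb
      rw [H.sq_of_eq_smul hy.self_of_nhds, Complex.norm_exp, ← Real.exp_nat_mul]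
      have : ((2 : ℕ) : ℝ) * (-G y / 2).re = -Real.log (H.sq σ y) + -(2 * esRho y) := by
        have h2 : (-G y / 2).re = -(G y).re / 2 := by simp
        rw [h2, hre]
        push_cast
        ring
      rw [this, Real.exp_add, Real.exp_neg, Real.exp_log hpos]
      simp only [W]
      field_simp
  obtain ⟨s, hs⟩ := LineConnection.exists_isFrameOn_univ hW hloc
  have hsS : IsSmoothSection s := IsSmoothSection.of_eventuallyEq fun x => by
    obtain ⟨t, ht, hev⟩ := hs x trivial
    exact ⟨t, ht, hev.mono fun y hy => hy.1⟩
  refine ⟨s, hsS, fun x => ?_, fun x =>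
    H.ne_zero_of_sq_pos (by rw [hs.sq_eq trivial]; exact hW x)⟩
  obtain ⟨t, ht, hev⟩ := hs x trivial
  rw [nab.dbar_congr hsS ht (hev.mono fun y hy => hy.1)]
  exact hev.self_of_nhds.2.1

end FramesOfPrescribedNorm

/-! ### The trivialization, integrability and the degree -/

section Trivialization

open Filter Topology InnerProductSpace Laplacian MeasureTheory

universe u

variable {E : ℂ → Type u} [TopologicalSpace (TotalSpace ℂ E)]
  [∀ x, AddCommGroup (E x)] [∀ x, Module ℂ (E x)] [∀ x, TopologicalSpace (E x)]
  [FiberBundle ℂ E] [VectorBundle ℂ ℂ E]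

/-- The fibrewise coordinate defined by a nowhere vanishing section. -/
noncomputable def HermitianStructure.coordEquiv (H : HermitianStructure E) {s : ∀ x, E x}
    (hs0 : ∀ x, s x ≠ 0) (x : ℂ) : E x ≃ₗ[ℂ] Bundle.Trivial ℂ ℂ x where
  toFun a := (H.inner x (s x) a / H.inner x (s x) (s x) : ℂ)
  map_add' a b := by rw [map_add]; exact add_div _ _ _
  map_smul' c a := by rw [map_smul]; exact mul_div_assoc _ _ _
  invFun c := (c : ℂ) • s x
  left_inv a := by
    obtain ⟨c, hc⟩ := exists_smul_eq_of_ne_zero (hs0 x) a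
    change (H.inner x (s x) a / H.inner x (s x) (s x) : ℂ) • s x = a
    rw [hc, map_smul, smul_eq_mul, mul_div_cancel_right₀ _ (H.inner_self_ne_zero (hs0 x))]
  right_inv c := by
    change (H.inner x (s x) ((c : ℂ) • s x) / H.inner x (s x) (s x) : ℂ) = c
    rw [map_smul, smul_eq_mul, mul_div_cancel_right₀ _ (H.inner_self_ne_zero (hs0 x))]

theorem HermitianStructure.coordEquiv_smul (H : HermitianStructure E) {s : ∀ x, E x}
    (hs0 : ∀ x, s x ≠ 0) (x c : ℂ) : H.coordEquiv hs0 x (c • s x) = c :=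
  (H.coordEquiv hs0 x).right_inv c

/-- A nowhere vanishing holomorphic section trivializes a holomorphic Hermitian line bundle. -/
noncomputable def HolomorphicHermitianIso.ofFrame (D : HolomorphicStructure E)
    (H : HermitianStructure E) {s : ∀ x, E x} (hs : IsSmoothSection s) (hs0 : ∀ x, s x ≠ 0)
    (hol : ∀ x, D.dbar s x = 0) (hα : ContDiff ℝ ∞ fun x => -Real.log (H.sq s x)) :
    HolomorphicHermitianIso D H trivialHolomorphic
      (trivialHermitian (fun x => -Real.log (H.sq s x)) hα) where
  toEquiv := H.coordEquiv hs0
  smooth_iff t := by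
    rw [isSmoothSection_trivial_iff]
    constructor
    · intro ht
      exact contDiff_iff_contDiffAt.mpr fun x => H.contDiffAt_coeff hs ht (hs0 x)
    · intro hc
      have h := hs.smul hc
      rwa [show (fun x => (H.coordEquiv hs0 x (t x) : ℂ) • s x) = t from
        funext fun x => H.coeff_smul t (hs0 x)] at h
  dbar_comm t ht x v := by
    have hc : ContDiff ℝ ∞ (H.coeff s t) :=
      contDiff_iff_contDiffAt.mpr fun x => H.contDiffAt_coeff hs ht (hs0 x)
    have h := D.leibniz _ s hc hs x v
    rw [show (fun y => H.coeff s t y • s y) = t from funext fun x => H.coeff_smul t (hs0 x), hol x,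
      LinearMap.zero_apply, smul_zero, add_zero] at h
    rw [h, H.coordEquiv_smul]
    rfl
  isometry x a b := by
    obtain ⟨c, rfl⟩ := exists_smul_eq_of_ne_zero (hs0 x) a
    obtain ⟨d, rfl⟩ := exists_smul_eq_of_ne_zero (hs0 x) b
    rw [H.coordEquiv_smul, H.coordEquiv_smul, map_smulₛₗ (H.inner x), LinearMap.smul_apply, map_smul,
      H.inner_self]
    change conj c * d * (Real.exp (-(-Real.log (H.sq s x))) : ℂ) = conj c * (d * (H.sq s x : ℂ))
    rw [neg_neg, Real.exp_log (H.sq_pos (hs0 x))]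
    ring

variable [IsSmoothLineBundle E]

theorem IsVortex.exists_holomorphic_frame {D : HolomorphicStructure E} {H : HermitianStructure E}
    {nab : LineConnection E} {Φ : ∀ x, E x} (hv : IsVortex 4 D H nab Φ) :
    ∃ (s : ∀ x, E x) (p : Polynomial ℂ), IsSmoothSection s ∧ (∀ x, nab.dbar s x = 0) ∧
      (∀ x, s x ≠ 0) ∧ p.natDegree ≤ 1 ∧ ∀ x, Φ x = p.eval x • s x := by
  rcases hv.eq_zero_or_exists_frame with h0 | h
  · obtain ⟨s, hs, hol, hne⟩ := hv.exists_frame_of_eq_zero h0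
    exact ⟨s, 0, hs, hol, hne, by simp, fun x => by simp [h0]⟩
  · exact h

/-- The bound |Φ|² ≤ 16 and the finite area give domination by 16w. -/
theorem IsVortex.integrable_density_mul_sq {D : HolomorphicStructure E} {H : HermitianStructure E}
    {nab : LineConnection E} {Φ : ∀ x, E x} (hv : IsVortex 4 D H nab Φ) :
    Integrable fun x => esDensity x * H.sq Φ x := by
  refine (integrable_esDensity.const_mul 16).mono'
    (contDiff_esDensity.continuous.mul
      (H.contDiff_sq hv.smooth).continuous).aestronglyMeasurable (Eventually.of_forall fun x => ?_)
  rw [Real.norm_of_nonneg (mul_nonneg (esDensity_pos x).le (H.sq_nonneg _ _)), mul_comm]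
  exact mul_le_mul_of_nonneg_right (hv.sq_le x) (esDensity_pos x).le

theorem IsVortex.integrable_curvature {D : HolomorphicStructure E} {H : HermitianStructure E}
    {nab : LineConnection E} {Φ : ∀ x, E x} (hv : IsVortex 4 D H nab Φ) :
    Integrable nab.curvature := by
  have h : Integrable fun x => esDensity x * (4 - H.sq Φ x) := by
    simp only [mul_sub]
    exact (integrable_esDensity.mul_const 4).sub hv.integrable_density_mul_sq
  exact (h.ofReal.const_mul (-(Complex.I / 2))).congr
    (Eventually.of_forall fun x => (hv.curvature_eq_density x).symm)

/-- The constants are (i/2π)(-i/2) = 1/4π and 4 · 2π = 8π, whence the leading term 2. -/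
theorem IsVortex.degree_eq {D : HolomorphicStructure E} {H : HermitianStructure E}
    {nab : LineConnection E} {Φ : ∀ x, E x} (hv : IsVortex 4 D H nab Φ) :
    nab.degree = ((2 - (4 * Real.pi)⁻¹ * ∫ x, esDensity x * H.sq Φ x : ℝ) : ℂ) := by
  have h : ∫ x, esDensity x * (4 - H.sq Φ x) =
      8 * Real.pi - ∫ x, esDensity x * H.sq Φ x := by
    simp only [mul_sub]
    rw [integral_sub (integrable_esDensity.mul_const 4) hv.integrable_density_mul_sq,
      integral_mul_const, integral_esDensity]
    ring
  have hpi : (Real.pi : ℂ) ≠ 0 := by exact_mod_cast Real.pi_ne_zero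
  rw [LineConnection.degree, integral_congr_ae (Eventually.of_forall hv.curvature_eq_density),
    integral_const_mul, integral_complex_ofReal, h]
  push_cast
  generalize (∫ x, esDensity x * H.sq Φ x : ℝ) = J
  field_simp
  linear_combination (-4 * (8 * (Real.pi : ℂ) - J)) * Complex.I_sq

theorem IsVortex.integral_density_mul_sq_pos {D : HolomorphicStructure E}
    {H : HermitianStructure E} {nab : LineConnection E} {Φ : ∀ x, E x}
    (hv : IsVortex 4 D H nab Φ) {x₀ : ℂ} (hx₀ : Φ x₀ ≠ 0) :
    0 < ∫ x, esDensity x * H.sq Φ x :=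
  integral_pos_of_integrable_nonneg_nonzero (x := x₀)
    (contDiff_esDensity.continuous.mul (H.contDiff_sq hv.smooth).continuous)
    hv.integrable_density_mul_sq
    (fun x => mul_nonneg (esDensity_pos x).le (H.sq_nonneg _ _))
    (mul_pos (esDensity_pos x₀) (H.sq_pos hx₀)).ne'

/-- Both sides equal (i/2) Δ log|s|². -/
theorem LineConnection.ddbar_neg_log_sq (nab : LineConnection E) {H : HermitianStructure E}
    (hH : nab.IsHermitian H) {s : ∀ x, E x} (hs : IsSmoothSection s) (hs0 : ∀ x, s x ≠ 0)
    (hol : ∀ x, nab.dbar s x = 0) :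
    ddbar (fun x => -Real.log (H.sq s x)) = nab.curvature := by
  funext x
  have hC : ContDiffAt ℝ 2 (fun x => Real.log (H.sq s x)) x :=
    (H.contDiffAt_log_sq hs (hs0 x)).of_le ENat.LEInfty.out
  rw [ddbar_eq_laplacian hC.neg, nab.curvature_eq_laplacian_log_sq hH hs (hs0 x)
    (Eventually.of_forall hol), show (fun x => -Real.log (H.sq s x)) =
      -fun x => Real.log (H.sq s x) from rfl, laplacian_neg]
  simp

end Trivialization

/-! ### The classification of 4-vortices -/

theorem mainTheorem8 {E : ℂ → Type*} [TopologicalSpace (TotalSpace ℂ E)]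
    [∀ x, AddCommGroup (E x)] [∀ x, Module ℂ (E x)] [∀ x, TopologicalSpace (E x)]
    [FiberBundle ℂ E] [VectorBundle ℂ ℂ E] [IsSmoothLineBundle E]
    (D : HolomorphicStructure E) (H : HermitianStructure E)
    (nab : LineConnection E) (Φ : ∀ x, E x) (hvortex : IsVortex 4 D H nab Φ) :
    ∃ (α : ℂ → ℝ) (hα : ContDiff ℝ ∞ α)
      (ψ : HolomorphicHermitianIso D H trivialHolomorphic (trivialHermitian α hα)),
      (MeasureTheory.Integrable nab.curvature ∧ MeasureTheory.Integrable (ddbar α) ∧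
        ∃ d : ℝ, nab.degree = d ∧ Complex.I / (2 * Real.pi) * ∫ x : ℂ, ddbar α x = d ∧
          ((∃ x, Φ x ≠ 0) → d < 2)) ∧
      ∃ p : Polynomial ℂ, p.natDegree ≤ 1 ∧ ∀ z : ℂ, ψ.toEquiv z (Φ z) = p.eval z := by
  obtain ⟨s, p, hs, hol, hs0, hp, hΦ⟩ := hvortex.exists_holomorphic_frame
  -- With this α the frame s corresponds to the constant 1, whose squared norm e^{-α} is |s|².
  have hα : ContDiff ℝ ∞ fun x => -Real.log (H.sq s x) :=
    contDiff_iff_contDiffAt.mpr fun x => (H.contDiffAt_log_sq hs (hs0 x)).neg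
  have hF := nab.ddbar_neg_log_sq hvortex.hermitian hs hs0 hol
  have hint := hvortex.integrable_curvature
  refine ⟨_, hα, HolomorphicHermitianIso.ofFrame D H hs hs0
    (fun x => (hvortex.compatible s hs x).symm.trans (hol x)) hα,
    ⟨hint, by rwa [hF], _, hvortex.degree_eq, ?_, ?_⟩, p, hp, fun z => ?_⟩
  · rw [hF, ← hvortex.degree_eq, LineConnection.degree]
  · rintro ⟨x₀, hx₀⟩
    have hpos := hvortex.integral_density_mul_sq_pos hx₀
    have hpi := Real.pi_pos
    have : 0 < (4 * Real.pi)⁻¹ * ∫ x, esDensity x * H.sq Φ x := by positivity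
    linarith
  · rw [hΦ]
    exact H.coordEquiv_smul hs0 z (p.eval z)
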